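/- Let $\Gamma$ be a discrete abelian group and $\ell^\infty(\Gamma)$ the space of bounded functions $\Gamma\to\mathbb C$. A mean is a linear functional $m:\ell^\infty(\Gamma)\to\mathbb C$ with $m(1_\Gamma)=1$ and $m(f)\ge 0$ whenever $f\ge 0$; write $m(A)=m(1_A)$ for $A\subseteq\Gamma$, and $A\subset_m B$ if $m(A\setminus B)=0$. A mean $m$ is invariant if $m(f_\gamma)=m(f)$ for all $f\in\ell^\infty(\Gamma)$ and $\gamma\in\Gamma$, where $f_\gamma(x)=f(x-\gamma)$; an extreme invariant mean is an extreme point of the convex set of invariant means. A mean $\eta$ is an FS-mean if for every action $U$ of $\Gamma$ by unitary operators on a complex Hilbert space $\mathcal H$ and all $v,w\in\mathcal H$, the mean $\eta$ of the function $\gamma\mapsto\langle v,U_\gamma w\rangle$ is $\langle v,Pw\rangle$, where $P$ is the orthogonal projection onto $\{x\in\mathcal H: U_\gamma x=x\text{ for all }\gamma\in\Gamma\}$. Let $\widehat\Gamma$ be the group of characters of $\Gamma$. Let $b\Gamma$ be the Bohr compactification of $\Gamma$, that is, the group of all homomorphisms $\widehat\Gamma\to\{z\in\mathbb C:|z|=1\}$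 with the topology of pointwise convergence, in which $\Gamma$ is embedded by $\gamma\mapsto(\chi\mapsto\chi(\gamma))$; let $\mu_{b\Gamma}$ be its Haar probability measure, and let $\tilde\chi:b\Gamma\to\mathbb C$, $\tilde\chi(x)=x(\chi)$, be the continuous extension of $\chi\in\widehat\Gamma$. For a mean $m$ and $f\in\ell^\infty(\Gamma)$ put $\hat f^{m}(\chi)=m(f\overline{\chi})$. If $m$ is an FS-mean (every invariant mean is one), the series $\tilde f^{(m)}=\sum_{\chi\in\widehat\Gamma}\hat f^{m}(\chi)\tilde\chi$ converges in $L^2(\mu_{b\Gamma})$; its sum is called the Besicovitch–Radon–Nikodym density of $f$ with respect to $m$. All series are unordered sums. **Lemma.** Let $\nu$ be an extreme invariant mean and $\eta$ an FS-mean on $\ell^\infty(\Gamma)$, let $A,B\subseteq\Gamma$, and let $f=1_A$, $g=1_B$. Then the series defining $\tilde f^{(\nu)}$ and $\tilde g^{(\eta)}$ converge in $L^2(\mu_{b\Gamma})$. Let $\tilde h=\tilde f^{(\nu)}*\tilde g^{(\eta)}$, that is, $\tilde h(x)=\int_{b\Gamma}\tilde f^{(\nu)}(t)\,\tilde g^{(\eta)}(x-t)\,d\mu_{b\Gamma}(t)$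 for $x\in b\Gamma$, and let $h=\tilde h|_\Gamma$. Then $\tilde h$ is real-valued, $h$ is bounded, the series $$\sum_{\chi\in\widehat\Gamma}\hat f^{\nu}(\chi)\,\hat g^{\eta}(\chi)\,\chi$$ converges uniformly on $\Gamma$ to $h$, and 1. $\nu(h\,1_{A+B})=\nu(h)$; 2. $\{h\ge\delta\}\subset_\nu A+B$ for every $\delta>0$; 3. if $V\subseteq\{\tilde h>0\}$ is compact, then $V\cap\Gamma\subset_\nu A+B$; 4. $\nu(A+B)\ge\mu_{b\Gamma}(\{\tilde h>0\})$. -/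

import Mathlib

open scoped Pointwise ENNReal Convolution

namespace DiscreteMeans

universe u

noncomputable section

/-! ### Bounded functions and means -/

/-- The Banach space `ℓ^∞(Γ)` of bounded complex-valued functions on `Γ`, with the supremum norm
and the pointwise `*`-algebra structure. -/
abbrev LInf (Γ : Type u) : Type u := lp (fun _ : Γ => ℂ) ∞

/-- A function bounded by `C` in absolute value, as an element of `ℓ^∞(Γ)`. -/
def LInf.mk {Γ : Type u} (f : Γ → ℂ) (C : ℝ) (hf : ∀ x, ‖f x‖ ≤ C) : LInf Γ :=
  ⟨f, memℓp_infty ⟨C, by rintro _ ⟨x, rfl⟩; exact hf x⟩⟩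

/-- The indicator function `1_A`. -/
def ind {Γ : Type u} (A : Set Γ) : LInf Γ :=
  LInf.mk (A.indicator 1) 1 fun x => by
    by_cases hx : x ∈ A <;> simp [hx]

/-- A mean on `ℓ^∞(Γ)`: a normalized positive linear functional. Here `0 ≤ z` for `z : ℂ` says that
`z` is a nonnegative real number. -/
def IsMean {Γ : Type u} (m : LInf Γ →ₗ[ℂ] ℂ) : Prop :=
  m 1 = 1 ∧ ∀ f : LInf Γ, (∀ x, (f x).im = 0 ∧ 0 ≤ (f x).re) → (m f).im = 0 ∧ 0 ≤ (m f).re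

/-- The finitely additive probability measure `A ↦ m(1_A)` on subsets of `Γ` (for a mean `m` the
number `m(1_A)` is real). -/
def meanMeasure {Γ : Type u} (m : LInf Γ →ₗ[ℂ] ℂ) (A : Set Γ) : ℝ := (m (ind A)).re

/-- `A ⊂_m B`: the set `A \ B` has `m`-measure zero. -/
def EssSubset {Γ : Type u} (m : LInf Γ →ₗ[ℂ] ℂ) (A B : Set Γ) : Prop :=
  meanMeasure m (A \ B) = 0

variable {Γ : Type u} [AddCommGroup Γ]

/-- The translate `f_γ(x) = f(x - γ)`. -/
def LInf.translate (γ : Γ) (f : LInf Γ) : LInf Γ :=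
  LInf.mk (fun x => f (x - γ)) ‖f‖ fun x => lp.norm_apply_le_norm ENNReal.top_ne_zero f (x - γ)

/-- A translation-invariant mean. -/
def IsInvariantMean (m : LInf Γ →ₗ[ℂ] ℂ) : Prop :=
  IsMean m ∧ ∀ (γ : Γ) (f : LInf Γ), m (LInf.translate γ f) = m f

/-- An extreme invariant mean: an extreme point of the convex set of invariant means. -/
def IsExtremeInvariantMean (ν : LInf Γ →ₗ[ℂ] ℂ) : Prop :=
  ν ∈ Set.extremePoints ℝ {m : LInf Γ →ₗ[ℂ] ℂ | IsInvariantMean m}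

/-! ### Unitary actions and FS-means -/

section Unitary

variable {H : Type*} [NormedAddCommGroup H] [InnerProductSpace ℂ H]

/-- The closed subspace of vectors fixed by a unitary action. -/
def invariantSubspace (U : Multiplicative Γ →* (H ≃ₗᵢ[ℂ] H)) : Submodule ℂ H where
  carrier := {x | ∀ γ : Γ, U (Multiplicative.ofAdd γ) x = x}
  add_mem' := fun ha hb γ => by rw [map_add, ha γ, hb γ]
  zero_mem' := fun γ => map_zero _
  smul_mem' := fun c x hx γ => by rw [map_smul, hx γ]

theorem isClosed_invariantSubspace (U : Multiplicative Γ →* (H ≃ₗᵢ[ℂ] H)) :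
    IsClosed (invariantSubspace U : Set H) := by
  have : (invariantSubspace U : Set H) = ⋂ γ : Γ, {x | U (Multiplicative.ofAdd γ) x = x} := by
    ext x; simp [invariantSubspace]
  rw [this]
  exact isClosed_iInter fun γ =>
    isClosed_eq (U (Multiplicative.ofAdd γ)).continuous continuous_id

instance [CompleteSpace H] (U : Multiplicative Γ →* (H ≃ₗᵢ[ℂ] H)) :
    CompleteSpace (invariantSubspace U) :=
  (isClosed_invariantSubspace U).completeSpace_coe

/-- The matrix coefficient `φ_{v,w}(γ) = ⟨v, U_γ w⟩`, for the inner product that is linear in the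
first variable; Mathlib's `inner` is linear in the second, which is why the arguments are swapped. -/
def matrixCoeff (U : Multiplicative Γ →* (H ≃ₗᵢ[ℂ] H)) (v w : H) : LInf Γ :=
  LInf.mk (fun γ => inner ℂ (U (Multiplicative.ofAdd γ) w) v) (‖w‖ * ‖v‖) fun γ => by
    simpa using norm_inner_le_norm (𝕜 := ℂ) (U (Multiplicative.ofAdd γ) w) v

end Unitary

/-- An FS-mean: a mean with `η(φ_{v,w}) = ⟨v, P w⟩` for every unitary action of `Γ` on a Hilbert
space, where `P` is the orthogonal projection onto the invariant vectors. It is enough to let the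
Hilbert space range over the universe of `Γ`: a matrix coefficient only involves the closed
invariant subspace generated by two vectors, and such a space has a Hilbert basis indexed by a
type in that universe. -/
def IsFSMean (η : LInf Γ →ₗ[ℂ] ℂ) : Prop :=
  IsMean η ∧
    ∀ (H : Type u) [NormedAddCommGroup H] [InnerProductSpace ℂ H] [CompleteSpace H]
      (U : Multiplicative Γ →* (H ≃ₗᵢ[ℂ] H)) (v w : H),
      η (matrixCoeff U v w) = inner ℂ ((invariantSubspace U).starProjection w) v

/-! ### Characters and Fourier coefficients -/

/-- A character `Γ → S¹` as an element of `ℓ^∞(Γ)`. -/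
def charInf (χ : AddChar Γ Circle) : LInf Γ :=
  LInf.mk (fun γ => (χ γ : ℂ)) 1 fun γ => (Circle.norm_coe (χ γ)).le

/-- The Fourier coefficient `m(f · conj χ)` of `f` with respect to the mean `m`. -/
def meanFourierCoeff (m : LInf Γ →ₗ[ℂ] ℂ) (f : LInf Γ) (χ : AddChar Γ Circle) : ℂ :=
  m (f * star (charInf χ))

/-! ### The Bohr compactification -/

/-- The group of all characters of `Γ`, with the discrete topology. -/
def DiscreteDual (Γ : Type u) [AddCommGroup Γ] : Type u := AddChar Γ Circle

instance : CommGroup (DiscreteDual Γ) := inferInstanceAs (CommGroup (AddChar Γ Circle))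

instance : TopologicalSpace (DiscreteDual Γ) := ⊥

instance : DiscreteTopology (DiscreteDual Γ) := ⟨rfl⟩

/-- The Bohr compactification `bΓ`, written additively: the Pontryagin dual of the group of
characters of `Γ` with the discrete topology. This is the standard model of the compact Hausdorff
abelian group that contains `Γ` as a dense subgroup and to which every character of `Γ` extends
continuously; it is unique up to isomorphism. -/
def Bohr (Γ : Type u) [AddCommGroup Γ] : Type u := Additive (PontryaginDual (DiscreteDual Γ))

instance : AddCommGroup (Bohr Γ) :=
  inferInstanceAs (AddCommGroup (Additive (PontryaginDual (DiscreteDual Γ))))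

instance : TopologicalSpace (Bohr Γ) :=
  inferInstanceAs (TopologicalSpace (Additive (PontryaginDual (DiscreteDual Γ))))

instance : IsTopologicalAddGroup (Bohr Γ) :=
  inferInstanceAs (IsTopologicalAddGroup (Additive (PontryaginDual (DiscreteDual Γ))))

instance : CompactSpace (Bohr Γ) :=
  inferInstanceAs (CompactSpace (PontryaginDual (DiscreteDual Γ)))

instance : T2Space (Bohr Γ) :=
  inferInstanceAs (T2Space (PontryaginDual (DiscreteDual Γ)))

instance : MeasurableSpace (Bohr Γ) := borel _

instance : BorelSpace (Bohr Γ) := ⟨rfl⟩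

/-- The value of a point of `bΓ` at a character of `Γ`. -/
def Bohr.eval (x : Bohr Γ) (χ : AddChar Γ Circle) : Circle :=
  (Additive.toMul (α := PontryaginDual (DiscreteDual Γ)) x : PontryaginDual (DiscreteDual Γ))
    (χ : DiscreteDual Γ)

theorem Bohr.continuous_eval (χ : AddChar Γ Circle) :
    Continuous fun x : Bohr Γ => x.eval χ :=
  (ContinuousEvalConst.continuous_eval_const (F := DiscreteDual Γ →ₜ* Circle)
    (χ : DiscreteDual Γ) :)

/-- Evaluation of characters at `γ`, as a homomorphism. -/
def DiscreteDual.evalHom (γ : Γ) : DiscreteDual Γ →* Circle where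
  toFun χ := (show AddChar Γ Circle from χ) γ
  map_one' := rfl
  map_mul' _ _ := rfl

/-- The embedding `ι : Γ → bΓ` given by `ι(γ)(χ) = χ(γ)`. -/
def Bohr.ofGroup (γ : Γ) : Bohr Γ :=
  Additive.ofMul (α := PontryaginDual (DiscreteDual Γ))
    (⟨DiscreteDual.evalHom γ, continuous_of_discreteTopology⟩ : DiscreteDual Γ →ₜ* Circle)

/-- The continuous extension `χ̃` to `bΓ` of a character `χ` of `Γ`. -/
def Bohr.extend (χ : AddChar Γ Circle) : C(Bohr Γ, ℂ) where
  toFun x := (x.eval χ : ℂ)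
  continuous_toFun := continuous_subtype_val.comp (Bohr.continuous_eval χ)

theorem Bohr.eval_ofGroup (γ : Γ) (χ : AddChar Γ Circle) : (Bohr.ofGroup γ).eval χ = χ γ := rfl

theorem Bohr.ofGroup_add (γ γ' : Γ) :
    Bohr.ofGroup (γ + γ') = Bohr.ofGroup γ + Bohr.ofGroup γ' :=
  congrArg Additive.ofMul (PontryaginDual.ext (A := DiscreteDual Γ) fun χ =>
    AddChar.map_add_eq_mul (show AddChar Γ Circle from χ) γ γ')

theorem Bohr.eval_add (x y : Bohr Γ) (χ : AddChar Γ Circle) :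
    (x + y).eval χ = x.eval χ * y.eval χ := rfl

/-- Haar probability measure on `bΓ`. -/
def bohrHaar (Γ : Type u) [AddCommGroup Γ] : MeasureTheory.Measure (Bohr Γ) :=
  MeasureTheory.Measure.addHaarMeasure ⊤

instance : (bohrHaar Γ).IsAddHaarMeasure :=
  MeasureTheory.Measure.isAddHaarMeasure_addHaarMeasure ⊤

instance : MeasureTheory.IsProbabilityMeasure (bohrHaar Γ) where
  measure_univ :=
    MeasureTheory.Measure.addHaarMeasure_self (K₀ := (⊤ : TopologicalSpace.PositiveCompacts _))

/-! ### The Besicovitch–Radon–Nikodym density and convolution -/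

/-- The term `f̂^m(χ) χ̃` of the Fourier series, in `L²(bΓ)`. -/
def densityTerm (m : LInf Γ →ₗ[ℂ] ℂ) (f : LInf Γ) (χ : AddChar Γ Circle) :
    MeasureTheory.Lp ℂ 2 (bohrHaar Γ) :=
  meanFourierCoeff m f χ • ContinuousMap.toLp (E := ℂ) 2 (bohrHaar Γ) ℂ (Bohr.extend χ)

/-- The Besicovitch–Radon–Nikodym density of `f` with respect to `m`: the sum of the series
`∑ f̂^m(χ) χ̃` in `L²(bΓ)`. -/
def density (m : LInf Γ →ₗ[ℂ] ℂ) (f : LInf Γ) : MeasureTheory.Lp ℂ 2 (bohrHaar Γ) :=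
  ∑' χ, densityTerm m f χ

/-- The convolution `(F * G)(x) = ∫ F(t) G(x - t) dt` of two elements of `L²(bΓ)`, as a function
defined everywhere on `bΓ`. -/
def bohrConv (F G : MeasureTheory.Lp ℂ 2 (bohrHaar Γ)) : Bohr Γ → ℂ :=
  F ⋆[ContinuousLinearMap.mul ℂ ℂ, bohrHaar Γ] G

end

end DiscreteMeans

open DiscreteMeans

/-! ### Means and their Hilbert spaces -/

namespace DiscreteMeans

universe u

open UniformSpace

noncomputable section

/-! ### Pointwise evaluation in `ℓ^∞` -/

section Pointwise

variable {X : Type u}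

/-! Completing `ℓ^∞(Γ)` for `ν(conj f · g)` gives a Hilbert space on which `Γ` acts by translation
and in which the characters are orthonormal. For bounded `k`, the correlation `γ ↦ ν(k · f_γ)` is a
matrix coefficient of this action. The core is the identity
`IsExtremeInvariantMean.hasSum_correlation`: the mean `η` of `g` times this correlation is `∑ f̂(χ)
ĝ(χ) ν(k χ)`, which is `ν(k h)`. If `f = 1_A`, `g = 1_B` and `k` vanishes on `A + B`, that product
is identically zero, so `ν(k h) = 0`. Everything about `A + B` follows: `k = 1 - 1_{A+B}` gives the
first claim, the indicator of `{h ≥ δ} \ (A + B)` the second, compactness the third. For the fourth,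
the indicator of `{h̃ > 0}` is approximated by continuous functions on `bΓ`, on whose restrictions
`ν` is the Haar integral (`map_restrict_eq_integral`).

To prove the identity, split `k` and `conj f` along the closed span of the characters and its
complement. The span contributes the series and cross terms vanish; what remains is `η(g φ_{u,v}) =
0` for `u`, `v` orthogonal to all characters. Two facts give this.

If `v` is orthogonal to every joint eigenvector, then `η(|φ_{v,v}|²) = 0`
(`IsFSMean.map_sq_matrixCoeff_self`): the FS property for conjugation on Hilbert–Schmidt operators
produces an invariant compact operator, and a nonzero one would have a joint eigenvector outside its
kernel. Cauchy–Schwarz then admits an arbitrary bounded factor `g`.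

Extremality forces `η(γ ↦ ν(k f_γ)) = ν(f) ν(k)` (`IsExtremeInvariantMean.correlationMean_eq`).
Twisted by a character, this shows that joint eigenvectors of translation are multiples of
characters, so the first fact applies. -/

theorem LInf.ext {f g : LInf X} (h : ∀ x, f x = g x) : f = g := lp.ext (funext h)

@[simp]
theorem LInf.add_apply (f g : LInf X) (x : X) : (f + g) x = f x + g x := rfl

@[simp]
theorem LInf.sub_apply (f g : LInf X) (x : X) : (f - g) x = f x - g x := rfl

@[simp]
theorem LInf.mul_apply (f g : LInf X) (x : X) : (f * g) x = f x * g x := rfl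

@[simp]
theorem LInf.smul_apply (c : ℂ) (f : LInf X) (x : X) : (c • f) x = c * f x := rfl

@[simp]
theorem LInf.star_apply (f : LInf X) (x : X) : (star f) x = star (f x) := rfl

@[simp]
theorem LInf.one_apply (x : X) : (1 : LInf X) x = 1 := rfl

theorem LInf.norm_apply_le (f : LInf X) (x : X) : ‖f x‖ ≤ ‖f‖ :=
  lp.norm_apply_le_norm ENNReal.top_ne_zero f x

@[simp]
theorem ind_apply (A : Set X) (x : X) : ind A x = A.indicator 1 x := rfl

theorem star_ind (A : Set X) : star (ind A) = ind A := by
  ext x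
  by_cases hx : x ∈ A <;> simp [hx]

end Pointwise

/-! ### Elementary properties of means -/

section Mean

variable {X : Type u} {m : LInf X →ₗ[ℂ] ℂ}

theorem IsMean.im_eq_zero (hm : IsMean m) {f : LInf X} (hf : ∀ x, (f x).im = 0) :
    (m f).im = 0 := by
  -- Adding the constant `‖f‖` makes a real function nonnegative.
  have h := (hm.2 (f + (‖f‖ : ℂ) • 1) fun x => ?_).1
  · simpa [hm.1] using h
  · have := (abs_le.1 ((Complex.abs_re_le_norm (f x)).trans (f.norm_apply_le x))).1
    refine ⟨by simp only [LInf.add_apply, LInf.smul_apply, LInf.one_apply, mul_one, Complex.add_im,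
      Complex.ofReal_im, hf x, add_zero], ?_⟩
    simp only [LInf.add_apply, LInf.smul_apply, LInf.one_apply, mul_one, Complex.add_re,
      Complex.ofReal_re]
    linarith

theorem IsMean.map_star (hm : IsMean m) (f : LInf X) : m (star f) = star (m f) := by
  have h1 := hm.im_eq_zero (f := f + star f) (by simp)
  have h2 := hm.im_eq_zero (f := Complex.I • (f - star f)) (by simp)
  simp only [map_add, map_smul, map_sub, smul_eq_mul] at h1 h2
  apply Complex.ext
  · simp at h2 ⊢
    linarith
  · simp at h1 ⊢
    linarith

theorem IsMean.re_mono (hm : IsMean m) {f g : LInf X} (hf : ∀ x, (f x).im = 0)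
    (hg : ∀ x, (g x).im = 0) (h : ∀ x, (f x).re ≤ (g x).re) : (m f).re ≤ (m g).re := by
  have := (hm.2 (g - f) fun x => by simp [hf, hg, h]).2
  simpa using this

theorem IsMean.norm_le (hm : IsMean m) {f : LInf X} {C : ℝ} (hf : ∀ x, ‖f x‖ ≤ C) :
    ‖m f‖ ≤ C := by
  -- A unimodular `c` rotates `m f` onto the nonnegative axis, so it suffices to bound the real part
  -- of `c • f`.
  obtain ⟨c, hc, hcf⟩ : ∃ c : ℂ, ‖c‖ = 1 ∧ c * m f = ‖m f‖ := by
    rcases eq_or_ne (m f) 0 with h | h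
    · exact ⟨1, by simp, by simp [h]⟩
    · refine ⟨star (m f) / ‖m f‖, by simp [h], ?_⟩
      have : (‖m f‖ : ℂ) ≠ 0 := by simpa using h
      field_simp
      rw [mul_comm]
      exact Complex.mul_conj' (m f)
  have h1 : (m (c • f + star (c • f))).re ≤ (m (((2 * C : ℝ) : ℂ) • 1)).re := by
    refine hm.re_mono (fun x => by simp; ring) (by simp) fun x => ?_
    have : (c * f x).re ≤ C := (Complex.re_le_norm _).trans (by simpa [hc] using hf x)
    simp at this ⊢
    linarith
  rw [map_add, hm.map_star, map_smul, smul_eq_mul, hcf, map_smul, hm.1] at h1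
  simp at h1
  linarith

theorem IsMean.norm_le_norm (hm : IsMean m) (f : LInf X) : ‖m f‖ ≤ ‖f‖ :=
  hm.norm_le f.norm_apply_le

theorem IsMean.map_const (hm : IsMean m) {f : LInf X} {c : ℂ} (hf : ∀ x, f x = c) : m f = c := by
  have : f = c • 1 := by
    ext x
    simp [hf]
  rw [this, map_smul, hm.1, smul_eq_mul, mul_one]

theorem IsMean.continuous (hm : IsMean m) : Continuous m :=
  (m.mkContinuous 1 fun f => by simpa using hm.norm_le_norm f).continuous

theorem IsMean.re_star_mul_self_nonneg (hm : IsMean m) (f : LInf X) : 0 ≤ (m (star f * f)).re := by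
  refine (hm.2 _ fun x => ?_).2
  simp [mul_comm (f x).re (f x).im]
  nlinarith [sq_nonneg (f x).re, sq_nonneg (f x).im]

end Mean

/-! ### The Hilbert space of a mean -/

section L2

variable {X : Type u}

/-- The space `ℓ^∞(X)`, to be equipped with the semi-inner product `(f, g) ↦ m(conj f · g)`. -/
def PreL2 {m : LInf X →ₗ[ℂ] ℂ} (_ : IsMean m) : Type u := LInf X

variable {m : LInf X →ₗ[ℂ] ℂ} (hm : IsMean m)

instance : AddCommGroup (PreL2 hm) := inferInstanceAs (AddCommGroup (LInf X))

instance : Module ℂ (PreL2 hm) := inferInstanceAs (Module ℂ (LInf X))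

/-- A bounded function as an element of the pre-Hilbert space of a mean. -/
def toPreL2 : LInf X ≃ₗ[ℂ] PreL2 hm := LinearEquiv.refl ℂ _

/-- The semi-inner product of a mean. -/
abbrev preL2Core : PreInnerProductSpace.Core ℂ (PreL2 hm) where
  inner f g := m (star ((toPreL2 hm).symm f) * (toPreL2 hm).symm g)
  conj_inner_symm f g := by
    change star _ = _
    rw [← hm.map_star]
    congr 1
    ext x
    simp [mul_comm]
  re_inner_nonneg f := hm.re_star_mul_self_nonneg _
  add_left f g h := by rw [map_add, star_add, add_mul, map_add]
  smul_left f g c := by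
    rw [map_smul, star_smul, smul_mul_assoc, map_smul]
    rfl

instance : SeminormedAddCommGroup (PreL2 hm) :=
  InnerProductSpace.Core.toSeminormedAddCommGroup (c := preL2Core hm)

instance : InnerProductSpace ℂ (PreL2 hm) := InnerProductSpace.ofCore (preL2Core hm)

theorem inner_toPreL2 (f g : LInf X) :
    inner ℂ (toPreL2 hm f) (toPreL2 hm g) = m (star f * g) := rfl

/-- The Hilbert space of a mean: the completion of `ℓ^∞(X)` for `(f, g) ↦ m(conj f · g)`. -/
abbrev MeanL2 : Type u := Completion (PreL2 hm)

/-- The class of a bounded function in the Hilbert space of a mean. -/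
def toL2 : LInf X →ₗ[ℂ] MeanL2 hm :=
  (Completion.toComplₗᵢ (𝕜 := ℂ) (E := PreL2 hm)).toLinearMap ∘ₗ (toPreL2 hm).toLinearMap

theorem toL2_eq_coe (f : LInf X) : toL2 hm f = ((toPreL2 hm f : PreL2 hm) : MeanL2 hm) := rfl

theorem inner_toL2 (f g : LInf X) : inner ℂ (toL2 hm f) (toL2 hm g) = m (star f * g) := by
  rw [toL2_eq_coe, toL2_eq_coe, Completion.inner_coe, inner_toPreL2]

theorem denseRange_toL2 : DenseRange (toL2 hm) :=
  Completion.denseRange_coe.comp (toPreL2 hm).surjective.denseRange (Completion.continuous_coe _)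

theorem ext_inner_toL2 {v w : MeanL2 hm}
    (h : ∀ k : LInf X, inner ℂ (toL2 hm k) v = inner ℂ (toL2 hm k) w) : v = w := by
  refine ext_inner_left ℂ fun x => ?_
  exact (denseRange_toL2 hm).induction_on x (isClosed_eq (by fun_prop) (by fun_prop)) h

/-- Cauchy–Schwarz in the form used for means: a vector of norm zero pairs to zero with everything.
-/
theorem IsMean.map_mul_eq_zero (hm : IsMean m) {f : LInf X} (hf : m (star f * f) = 0) (g : LInf X) :
    m (g * f) = 0 := by
  have h0 : toL2 hm f = 0 := by rw [← inner_self_eq_zero (𝕜 := ℂ), inner_toL2, hf]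
  have h1 := inner_toL2 hm (star g) f
  rwa [h0, inner_zero_right, star_star, eq_comm] at h1

end L2

/-! ### Unitary actions on completions -/

section Completion

variable {E : Type u} [SeminormedAddCommGroup E] [InnerProductSpace ℂ E]

/-- The extension of a linear isometric automorphism to the completion. -/
def completionIsometry (e : E ≃ₗᵢ[ℂ] E) : Completion E ≃ₗᵢ[ℂ] Completion E where
  toFun := (e : E →L[ℂ] E).completion
  invFun := (e.symm : E →L[ℂ] E).completion
  map_add' := map_add _
  map_smul' := map_smul _
  left_inv x := by
    induction x using Completion.induction_on with
    | hp => exact isClosed_eq (by fun_prop) (by fun_prop)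
    | ih x => simp
  right_inv x := by
    induction x using Completion.induction_on with
    | hp => exact isClosed_eq (by fun_prop) (by fun_prop)
    | ih x => simp
  norm_map' x := by
    change ‖(e : E →L[ℂ] E).completion x‖ = _
    induction x using Completion.induction_on with
    | hp => exact isClosed_eq (by fun_prop) (by fun_prop)
    | ih x => simp

@[simp]
theorem completionIsometry_coe (e : E ≃ₗᵢ[ℂ] E) (x : E) :
    completionIsometry e x = (e x : Completion E) :=
  (e : E →L[ℂ] E).completion_apply_coe x

/-- The extension of a unitary action to the completion. -/
def completionAction {G : Type*} [Group G] (U : G →* (E ≃ₗᵢ[ℂ] E)) :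
    G →* (Completion E ≃ₗᵢ[ℂ] Completion E) where
  toFun g := completionIsometry (U g)
  map_one' := by
    ext x
    induction x using Completion.induction_on with
    | hp => exact isClosed_eq (LinearIsometryEquiv.continuous _) (LinearIsometryEquiv.continuous _)
    | ih x => simp
  map_mul' g h := by
    ext x
    induction x using Completion.induction_on with
    | hp => exact isClosed_eq (LinearIsometryEquiv.continuous _) (LinearIsometryEquiv.continuous _)
    | ih x => simp

@[simp]
theorem completionAction_coe {G : Type*} [Group G] (U : G →* (E ≃ₗᵢ[ℂ] E)) (g : G) (x : E) :
    completionAction U g (x : Completion E) = (U g x : Completion E) :=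
  completionIsometry_coe _ _

end Completion

end

end DiscreteMeans

/-! ### Hilbert–Schmidt operators, joint eigenvectors and weak mixing -/

namespace DiscreteMeans

universe u

open UniformSpace TensorProduct InnerProductSpace

noncomputable section

/-! ### The conjugate of an inner product space -/

section Conj

/-- The complex conjugate of a complex vector space. -/
def ConjSpace (H : Type u) : Type u := H

variable {H : Type u} [NormedAddCommGroup H] [InnerProductSpace ℂ H]

instance : NormedAddCommGroup (ConjSpace H) := inferInstanceAs (NormedAddCommGroup H)

/-- The identity, as a map to the conjugate space. -/
def toConj : H ≃+ ConjSpace H := AddEquiv.refl H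

instance : Module ℂ (ConjSpace H) where
  smul c x := toConj (star c • toConj.symm x)
  one_smul x := show star (1 : ℂ) • toConj.symm x = toConj.symm x by simp
  mul_smul c d x := show star (c * d) • toConj.symm x = star c • star d • toConj.symm x by
    rw [star_mul', mul_smul]
  smul_zero c := show star c • (0 : H) = 0 from smul_zero _
  smul_add c x y := show star c • (toConj.symm x + toConj.symm y) =
      star c • toConj.symm x + star c • toConj.symm y from smul_add _ _ _
  add_smul c d x := show star (c + d) • toConj.symm x =
      star c • toConj.symm x + star d • toConj.symm x by rw [star_add, add_smul]
  zero_smul x := show star (0 : ℂ) • toConj.symm x = 0 by simp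

theorem toConj_smul (c : ℂ) (x : H) : toConj (c • x) = star c • toConj x :=
  show c • x = star (star c) • x by rw [star_star]

instance : NormedSpace ℂ (ConjSpace H) where
  norm_smul_le c x := (norm_smul_le (star c) (toConj.symm x)).trans_eq (by rw [norm_star]; rfl)

instance : InnerProductSpace ℂ (ConjSpace H) where
  inner x y := inner ℂ (toConj.symm y) (toConj.symm x)
  norm_sq_eq_re_inner x := norm_sq_eq_re_inner (𝕜 := ℂ) (toConj.symm x)
  conj_inner_symm x y := inner_conj_symm (𝕜 := ℂ) (toConj.symm y) (toConj.symm x)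
  add_left x y z := inner_add_right (toConj.symm z) (toConj.symm x) (toConj.symm y)
  smul_left x y c := inner_smul_right (toConj.symm y) (toConj.symm x) (star c)

theorem inner_toConj (x y : H) : inner ℂ (toConj x) (toConj y) = inner ℂ y x := rfl

/-- A linear isometric automorphism, acting on the conjugate space. -/
def conjIsometry (e : H ≃ₗᵢ[ℂ] H) : ConjSpace H ≃ₗᵢ[ℂ] ConjSpace H where
  toFun x := toConj (e (toConj.symm x))
  invFun x := toConj (e.symm (toConj.symm x))
  left_inv x := e.symm_apply_apply (toConj.symm x)
  right_inv x := e.apply_symm_apply (toConj.symm x)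
  map_add' x y := e.map_add (toConj.symm x) (toConj.symm y)
  map_smul' c x := e.map_smul (star c) (toConj.symm x)
  norm_map' x := e.norm_map (toConj.symm x)

end Conj

/-! ### Hilbert–Schmidt operators -/

section HilbertSchmidt

/-- The Hilbert space of Hilbert–Schmidt operators on `H`, as a completed tensor product. -/
abbrev HS (H : Type u) [NormedAddCommGroup H] [InnerProductSpace ℂ H] : Type u :=
  Completion (H ⊗[ℂ] ConjSpace H)

variable {H : Type u} [NormedAddCommGroup H] [InnerProductSpace ℂ H]

/-- The operator `z ↦ ⟨y, z⟩ x`, as an element of the Hilbert–Schmidt class. -/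
def HS.rankOne (x y : H) : HS H := ((x ⊗ₜ[ℂ] toConj y : H ⊗[ℂ] ConjSpace H) : HS H)

theorem HS.inner_rankOne (x y x' y' : H) :
    inner ℂ (HS.rankOne x y) (HS.rankOne x' y') = inner ℂ x x' * inner ℂ y' y := by
  rw [HS.rankOne, HS.rankOne, Completion.inner_coe, TensorProduct.inner_tmul, inner_toConj]

theorem HS.norm_rankOne (x y : H) : ‖HS.rankOne x y‖ = ‖x‖ * ‖y‖ := by
  rw [HS.rankOne, Completion.norm_coe, TensorProduct.norm_tmul]
  rfl

/-- The conjugation action `T ↦ U T U⁻¹` on Hilbert–Schmidt operators. -/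
def HS.action {G : Type*} [Group G] (U : G →* (H ≃ₗᵢ[ℂ] H)) : G →* (HS H ≃ₗᵢ[ℂ] HS H) :=
  completionAction
    { toFun g := TensorProduct.congrIsometry (U g) (conjIsometry (U g))
      map_one' := by
        ext z
        induction z with
        | zero => simp
        | add a b ha hb => rw [map_add, ha, hb, map_add]
        | tmul a b => rw [map_one]; rfl
      map_mul' g h := by
        ext z
        induction z with
        | zero => simp
        | add a b ha hb => rw [map_add, ha, hb, map_add]
        | tmul a b => rw [map_mul]; rfl }

theorem HS.action_rankOne {G : Type*} [Group G] (U : G →* (H ≃ₗᵢ[ℂ] H)) (g : G) (x y : H) :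
    HS.action U g (HS.rankOne x y) = HS.rankOne (U g x) (U g y) :=
  completionAction_coe _ _ _

theorem HS.ext_inner_rankOne {Q R : HS H}
    (h : ∀ x y, inner ℂ (HS.rankOne x y) Q = inner ℂ (HS.rankOne x y) R) : Q = R := by
  refine ext_inner_left ℂ fun z => ?_
  induction z using Completion.induction_on with
  | hp => exact isClosed_eq (by fun_prop) (by fun_prop)
  | ih z =>
    induction z with
    | zero => rw [Completion.coe_zero, inner_zero_left, inner_zero_left]
    | add a b ha hb => rw [Completion.coe_add, inner_add_left, inner_add_left, ha, hb]
    | tmul a b => exact h a (toConj.symm b)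

variable [CompleteSpace H]

/-- The sesquilinear form of a Hilbert–Schmidt operator. -/
def HS.form (Q : HS H) : H →L⋆[ℂ] H →L[ℂ] ℂ :=
  LinearMap.mkContinuous₂
    (LinearMap.mk₂'ₛₗ (starRingEnd ℂ) (RingHom.id ℂ)
      (fun y x => inner ℂ Q (HS.rankOne x y))
      (fun y y' x => by
        rw [HS.rankOne, map_add, tmul_add, Completion.coe_add, inner_add_right]; rfl)
      (fun c y x => by
        rw [HS.rankOne, toConj_smul, tmul_smul, Completion.coe_smul, inner_smul_right]; rfl)
      (fun y x x' => by
        rw [HS.rankOne, add_tmul, Completion.coe_add, inner_add_right]; rfl)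
      (fun c y x => by
        rw [HS.rankOne, ← smul_tmul', Completion.coe_smul, inner_smul_right]; rfl))
    ‖Q‖ fun y x => by
      refine (norm_inner_le_norm (𝕜 := ℂ) Q (HS.rankOne x y)).trans ?_
      rw [HS.norm_rankOne, mul_comm ‖x‖, mul_assoc]

/-- The bounded operator of a Hilbert–Schmidt operator. -/
def HS.toOp (Q : HS H) : H →L[ℂ] H := continuousLinearMapOfBilin (HS.form Q)

theorem HS.inner_toOp_left (Q : HS H) (x y : H) :
    inner ℂ (Q.toOp y) x = inner ℂ Q (HS.rankOne x y) :=
  continuousLinearMapOfBilin_apply _ _ _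

theorem HS.inner_toOp_right (Q : HS H) (x y : H) :
    inner ℂ x (Q.toOp y) = inner ℂ (HS.rankOne x y) Q := by
  rw [← inner_conj_symm, HS.inner_toOp_left, inner_conj_symm]

theorem HS.toOp_add (Q R : HS H) : (Q + R).toOp = Q.toOp + R.toOp := by
  ext y
  refine ext_inner_left ℂ fun x => ?_
  rw [HS.inner_toOp_right, add_apply, inner_add_right, inner_add_right,
    HS.inner_toOp_right, HS.inner_toOp_right]

theorem HS.toOp_smul (c : ℂ) (Q : HS H) : (c • Q).toOp = c • Q.toOp := by
  ext y
  refine ext_inner_left ℂ fun x => ?_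
  rw [HS.inner_toOp_right, smul_apply, inner_smul_right, inner_smul_right,
    HS.inner_toOp_right]

theorem HS.norm_toOp_le (Q : HS H) : ‖Q.toOp‖ ≤ ‖Q‖ := by
  refine ContinuousLinearMap.opNorm_le_bound _ (norm_nonneg _) fun y => ?_
  rcases eq_or_ne (Q.toOp y) 0 with h | h
  · rw [h, norm_zero]
    positivity
  · have h1 : ‖Q.toOp y‖ * ‖Q.toOp y‖ ≤ ‖Q.toOp y‖ * (‖Q‖ * ‖y‖) := by
      have := norm_inner_le_norm (𝕜 := ℂ) (HS.rankOne (Q.toOp y) y) Q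
      rw [← HS.inner_toOp_right, HS.norm_rankOne, inner_self_eq_norm_sq_to_K] at this
      simp only [norm_pow, RCLike.norm_ofReal, abs_norm] at this
      linarith
    exact le_of_mul_le_mul_left h1 (norm_pos_iff.2 h)

theorem HS.continuous_toOp : Continuous (HS.toOp (H := H)) :=
  (LinearMap.mkContinuous (⟨⟨HS.toOp, HS.toOp_add⟩, HS.toOp_smul⟩ : HS H →ₗ[ℂ] (H →L[ℂ] H)) 1
    fun Q => by simpa using Q.norm_toOp_le).continuous

/-- Elementary tensors give operators of rank at most one, sums of these are dense, and compact
operators are closed in operator norm. -/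
theorem HS.isCompactOperator_toOp (Q : HS H) : IsCompactOperator Q.toOp := by
  induction Q using Completion.induction_on with
  | hp => exact isClosed_setOfPred_isCompactOperator.preimage HS.continuous_toOp
  | ih z =>
    induction z with
    | zero =>
      have : HS.toOp (((0 : H ⊗[ℂ] ConjSpace H) : HS H)) = 0 := by
        have := HS.toOp_smul (0 : ℂ) (0 : HS H)
        rw [zero_smul, zero_smul] at this
        exact this
      rw [this]
      exact isCompactOperator_zero
    | add a b ha hb =>
      rw [Completion.coe_add, HS.toOp_add]
      exact ha.add hb
    | tmul a b =>
      have : HS.toOp ((a ⊗ₜ[ℂ] b : H ⊗[ℂ] ConjSpace H) : HS H) =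
          (ContinuousLinearMap.toSpanSingleton ℂ a).comp (innerSL ℂ (toConj.symm b)) := by
        ext y
        refine ext_inner_left ℂ fun x => ?_
        have h := HS.inner_rankOne x y a (toConj.symm b)
        rw [HS.inner_toOp_right]
        refine h.trans ?_
        simp [inner_smul_right, mul_comm]
      rw [this]
      exact (isCompactOperator_of_locallyCompactSpace_rng
        (ContinuousLinearMap.toSpanSingleton ℂ a)).comp_clm (innerSL ℂ (toConj.symm b))

theorem HS.toOp_comm_of_invariant {e : H ≃ₗᵢ[ℂ] H} {Q : HS H}
    (h : ∀ x y, inner ℂ (HS.rankOne (e x) (e y)) Q = inner ℂ (HS.rankOne x y) Q) (y : H) :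
    Q.toOp (e y) = e (Q.toOp y) := by
  refine ext_inner_left ℂ fun x => ?_
  obtain ⟨x, rfl⟩ := e.surjective x
  rw [HS.inner_toOp_right, h, e.inner_map_map, HS.inner_toOp_right]

end HilbertSchmidt

/-! ### Joint eigenvectors -/

/-- Induction on the dimension: if every operator is scalar on `V`, any nonzero vector works;
otherwise an eigenspace of a nonscalar one is proper, nonzero and, by commutation, stable under the
others. -/
theorem exists_joint_eigenvector {ι : Type*} {H : Type*} [AddCommGroup H] [Module ℂ H]
    (T : ι → Module.End ℂ H) (hT : ∀ i j, Commute (T i) (T j)) (V : Submodule ℂ H)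
    [FiniteDimensional ℂ V] (hV : V ≠ ⊥) (hinv : ∀ i, ∀ x ∈ V, T i x ∈ V) :
    ∃ w ∈ V, w ≠ 0 ∧ ∃ c : ι → ℂ, ∀ i, T i w = c i • w := by
  induction hn : Module.finrank ℂ V using Nat.strong_induction_on generalizing V with
  | _ n ih =>
  by_cases hs : ∀ i, ∃ c : ℂ, ∀ x ∈ V, T i x = c • x
  · choose c hc using hs
    obtain ⟨w, hw, hw0⟩ := V.exists_mem_ne_zero_of_ne_bot hV
    exact ⟨w, hw, hw0, c, fun i => hc i w hw⟩
  · push Not at hs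
    obtain ⟨i, hi⟩ := hs
    have : Nontrivial V := Submodule.nontrivial_iff_ne_bot.2 hV
    obtain ⟨μ, hμ⟩ := Module.End.exists_eigenvalue ((T i).restrict (hinv i))
    obtain ⟨x, hx⟩ := hμ.exists_hasEigenvector
    have hle : V ⊓ (T i).eigenspace μ ≤ V := inf_le_left
    have hxmem : (x : H) ∈ V ⊓ (T i).eigenspace μ := by
      refine ⟨x.2, Module.End.mem_eigenspace_iff.2 ?_⟩
      exact congrArg Subtype.val hx.apply_eq_smul
    have : FiniteDimensional ℂ ↥(V ⊓ (T i).eigenspace μ) := Submodule.finiteDimensional_of_le hle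
    have hlt : V ⊓ (T i).eigenspace μ < V := by
      refine lt_of_le_of_ne hle fun h => ?_
      obtain ⟨y, hy, hne⟩ := hi μ
      rw [← h] at hy
      exact hne (Module.End.mem_eigenspace_iff.1 hy.2)
    obtain ⟨w, hw, h⟩ := ih _ (hn ▸ Submodule.finrank_lt_finrank_of_lt hlt) _
      (fun h => hx.2 (by rw [h] at hxmem; simpa using hxmem))
      (fun j y hy => Submodule.mem_inf.2 ⟨hinv j y hy.1, by
        have h1 := Module.End.mem_eigenspace_iff.1 hy.2
        have h2 : T i (T j y) = T j (T i y) := congrArg (fun S : Module.End ℂ H => S y) (hT i j)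
        exact Module.End.mem_eigenspace_iff.2 (by rw [h2, h1, map_smul])⟩) rfl
    exact ⟨w, hw.1, h⟩

theorem isometry_mul_apply {H : Type*} [NormedAddCommGroup H] [InnerProductSpace ℂ H]
    (e e' : H ≃ₗᵢ[ℂ] H) (x : H) : (e * e') x = e (e' x) := rfl

/-! ### Matrix coefficients orthogonal to the joint eigenvectors -/

section WeakMixing

variable {Γ : Type u} [AddCommGroup Γ] {H : Type u} [NormedAddCommGroup H]
  [InnerProductSpace ℂ H]

@[simp]
theorem matrixCoeff_apply (U : Multiplicative Γ →* (H ≃ₗᵢ[ℂ] H)) (v w : H) (γ : Γ) :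
    matrixCoeff U v w γ = inner ℂ (U (Multiplicative.ofAdd γ) w) v := rfl

variable [CompleteSpace H]

/-- Since `T` need not be normal, the spectral theorem is applied to the compact self-adjoint `T*
T`, which also commutes with the isometries. An eigenspace for a nonzero eigenvalue is
finite-dimensional and meets the kernel of `T` only in zero. -/
theorem exists_joint_eigenvector_of_isCompactOperator {ι : Type*} (e : ι → (H ≃ₗᵢ[ℂ] H))
    (he : ∀ i j x, e i (e j x) = e j (e i x)) (T : H →L[ℂ] H) (hT : IsCompactOperator T)
    (hT0 : T ≠ 0) (hcomm : ∀ i x, T (e i x) = e i (T x)) :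
    ∃ w, T w ≠ 0 ∧ ∃ c : ι → ℂ, ∀ i, e i w = c i • w := by
  set S : H →L[ℂ] H := (ContinuousLinearMap.adjoint T).comp T with hS
  have hSc : IsCompactOperator S := hT.clm_comp (ContinuousLinearMap.adjoint T)
  have hSs : S.IsSymmetric := fun x y => by
    change inner ℂ (ContinuousLinearMap.adjoint T (T x)) y =
      inner ℂ x (ContinuousLinearMap.adjoint T (T y))
    rw [ContinuousLinearMap.adjoint_inner_left, ContinuousLinearMap.adjoint_inner_right]
  have hScomm : ∀ i x, S (e i x) = e i (S x) := fun i x => by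
    refine ext_inner_left ℂ fun y => ?_
    obtain ⟨y, rfl⟩ := (e i).surjective y
    change inner ℂ _ (ContinuousLinearMap.adjoint T (T (e i x))) =
      inner ℂ _ (e i (ContinuousLinearMap.adjoint T (T x)))
    rw [ContinuousLinearMap.adjoint_inner_right, hcomm, hcomm, LinearIsometryEquiv.inner_map_map,
      LinearIsometryEquiv.inner_map_map, ContinuousLinearMap.adjoint_inner_right]
  have hS0 : S ≠ 0 := fun h => hT0 <| by
    ext x
    have : inner ℂ (S x) x = 0 := by rw [h]; simp
    change inner ℂ (ContinuousLinearMap.adjoint T (T x)) x = 0 at this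
    rwa [ContinuousLinearMap.adjoint_inner_left, inner_self_eq_zero] at this
  obtain ⟨μ, hμ, hμ0⟩ : ∃ μ, Module.End.HasEigenvalue (S : Module.End ℂ H) μ ∧ μ ≠ 0 := by
    by_contra! h
    exact hS0 ((ContinuousLinearMap.eq_zero_of_forall_hasEigenvalue_eq_zero hSc hSs).1 h)
  have := ContinuousLinearMap.finite_dimensional_eigenspace hSc μ hμ0
  obtain ⟨w, hw, hw0, hc⟩ := exists_joint_eigenvector
    (fun i => ((e i).toLinearEquiv : Module.End ℂ H))
    (fun i j => LinearMap.ext fun x => he i j x)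
    (Module.End.eigenspace (S : Module.End ℂ H) μ) hμ (fun i x hx => by
      have hx' : S x = μ • x := Module.End.mem_eigenspace_iff.1 hx
      refine Module.End.mem_eigenspace_iff.2 ?_
      change S (e i x) = μ • e i x
      rw [hScomm, hx', map_smul])
  refine ⟨w, fun h => ?_, hc⟩
  have hw' : S w = μ • w := Module.End.mem_eigenspace_iff.1 hw
  have : S w = 0 := by
    change ContinuousLinearMap.adjoint T (T w) = 0
    rw [h, map_zero]
  rw [this, eq_comm, smul_eq_zero] at hw'
  exact hw'.elim hμ0 hw0

/-- `|φ_{v,v}|²` is the diagonal matrix coefficient of `v ⊗ conj v` under conjugation, so its mean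
is the pairing of `v ⊗ conj v` with its invariant projection `Q`. The operator of `Q` is compact and
commutes with `U`; the hypothesis on `v` makes it kill every joint eigenvector, hence vanish. -/
theorem IsFSMean.map_sq_matrixCoeff_self {η : LInf Γ →ₗ[ℂ] ℂ} (hη : IsFSMean η)
    (U : Multiplicative Γ →* (H ≃ₗᵢ[ℂ] H)) (v : H)
    (hv : ∀ (w : H) (c : Multiplicative Γ → ℂ), (∀ g, U g w = c g • w) → inner ℂ w v = 0) :
    η (star (matrixCoeff U v v) * matrixCoeff U v v) = 0 := by
  set Q : HS H := (invariantSubspace (HS.action U)).starProjection (HS.rankOne v v) with hQ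
  have hinv : ∀ g, HS.action U g Q = Q := fun g =>
    (Submodule.starProjection_apply_mem _ _ : Q ∈ invariantSubspace (HS.action U))
      (Multiplicative.toAdd g)
  have hfs : ∀ a : HS H, η (matrixCoeff (HS.action U) a (HS.rankOne v v)) = inner ℂ Q a :=
    fun a => hη.2 (HS H) (HS.action U) a (HS.rankOne v v)
  have hzero : Q.toOp = 0 := by
    by_contra hne
    obtain ⟨w, hw, c, hc⟩ := exists_joint_eigenvector_of_isCompactOperator (fun g => U g)
      (fun g h x => by
        rw [← isometry_mul_apply, ← map_mul, mul_comm, map_mul,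
          isometry_mul_apply])
      Q.toOp Q.isCompactOperator_toOp hne
      (fun g x => HS.toOp_comm_of_invariant (fun x y => by
        conv_lhs => rw [← hinv g, ← HS.action_rankOne, LinearIsometryEquiv.inner_map_map]) x)
    refine hw (ext_inner_right ℂ fun x => ?_)
    rw [HS.inner_toOp_left, ← hfs, inner_zero_left]
    convert map_zero η
    ext γ
    rw [matrixCoeff_apply, HS.action_rankOne, HS.inner_rankOne]
    -- Moving `U` to the eigenvector `w` only changes it by a scalar.
    have h1 : inner ℂ w (U (Multiplicative.ofAdd γ) v) = 0 := by
      have h2 := (U (Multiplicative.ofAdd γ)).inner_map_map (U (Multiplicative.ofAdd γ)⁻¹ w) v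
      rw [← isometry_mul_apply, ← map_mul, mul_inv_cancel, map_one, hc, inner_smul_left,
        hv w c hc, mul_zero] at h2
      exact h2
    rw [h1, mul_zero]
    rfl
  have hQ0 : Q = 0 := HS.ext_inner_rankOne fun x y => by
    rw [← HS.inner_toOp_right, hzero, inner_zero_right]
    simp
  have := hfs (HS.rankOne v v)
  rw [hQ0, inner_zero_left] at this
  rw [← this]
  congr 1
  ext γ
  rw [matrixCoeff_apply, HS.action_rankOne, HS.inner_rankOne, LInf.mul_apply, LInf.star_apply,
    matrixCoeff_apply, mul_comm]
  congr 1
  exact inner_conj_symm _ _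

end WeakMixing

end

end DiscreteMeans

/-! ### Characters, the translation action and the use of extremality -/

namespace DiscreteMeans

universe u

open UniformSpace

noncomputable section

variable {Γ : Type u} [AddCommGroup Γ]

/-! ### Characters -/

@[simp]
theorem LInf.translate_apply (γ : Γ) (f : LInf Γ) (x : Γ) :
    LInf.translate γ f x = f (x - γ) := rfl

@[simp]
theorem charInf_apply (χ : AddChar Γ Circle) (x : Γ) : charInf χ x = (χ x : ℂ) := rfl

theorem charInf_one : charInf (1 : AddChar Γ Circle) = 1 := by
  ext x
  simp

theorem charInf_mul (χ ψ : AddChar Γ Circle) : charInf (χ * ψ) = charInf χ * charInf ψ := by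
  ext x
  simp

theorem charInf_inv (χ : AddChar Γ Circle) : charInf χ⁻¹ = star (charInf χ) := by
  ext x
  rw [charInf_apply, AddChar.inv_apply', Circle.coe_inv_eq_conj]
  rfl

theorem star_mul_self_char (χ : AddChar Γ Circle) (x : Γ) :
    (starRingEnd ℂ) (χ x : ℂ) * (χ x : ℂ) = 1 := by
  rw [← Circle.coe_inv_eq_conj, ← Circle.coe_mul, inv_mul_cancel, Circle.coe_one]

theorem norm_charInf_le (χ : AddChar Γ Circle) : ‖charInf χ‖ ≤ 1 :=
  lp.norm_le_of_forall_le zero_le_one fun x => (Circle.norm_coe (χ x)).le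

theorem AddChar.exists_apply_ne_one {χ : AddChar Γ Circle} (h : χ ≠ 1) : ∃ γ, χ γ ≠ 1 := by
  by_contra! hc
  exact h (DFunLike.ext _ _ hc)

/-- A unitary action, multiplied by a character. -/
def twist {H : Type*} [NormedAddCommGroup H] [InnerProductSpace ℂ H] (χ : AddChar Γ Circle)
    (U : Multiplicative Γ →* (H ≃ₗᵢ[ℂ] H)) : Multiplicative Γ →* (H ≃ₗᵢ[ℂ] H) where
  toFun g :=
    { toFun x := (χ g.toAdd : ℂ) • U g x
      invFun x := (starRingEnd ℂ) (χ g.toAdd : ℂ) • (U g).symm x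
      map_add' x y := by rw [map_add, smul_add]
      map_smul' c x := by rw [map_smul, smul_comm, RingHom.id_apply]
      left_inv x := by
        change (starRingEnd ℂ) (χ g.toAdd : ℂ) • (U g).symm ((χ g.toAdd : ℂ) • U g x) = x
        rw [map_smul, smul_smul, star_mul_self_char, one_smul, LinearIsometryEquiv.symm_apply_apply]
      right_inv x := by
        change (χ g.toAdd : ℂ) • U g ((starRingEnd ℂ) (χ g.toAdd : ℂ) • (U g).symm x) = x
        rw [map_smul, smul_smul, mul_comm, star_mul_self_char, one_smul,
          LinearIsometryEquiv.apply_symm_apply]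
      norm_map' x := by
        change ‖(χ g.toAdd : ℂ) • U g x‖ = _
        rw [norm_smul, Circle.norm_coe, one_mul, LinearIsometryEquiv.norm_map] }
  map_one' := by
    ext x
    change (χ 0 : ℂ) • U 1 x = x
    simp
  map_mul' g h := by
    ext x
    change (χ (g.toAdd + h.toAdd) : ℂ) • U (g * h) x =
      (χ g.toAdd : ℂ) • U g ((χ h.toAdd : ℂ) • U h x)
    rw [AddChar.map_add_eq_mul, map_mul, map_smul, smul_smul, Circle.coe_mul, isometry_mul_apply]

theorem twist_apply {H : Type*} [NormedAddCommGroup H] [InnerProductSpace ℂ H]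
    (χ : AddChar Γ Circle) (U : Multiplicative Γ →* (H ≃ₗᵢ[ℂ] H)) (γ : Γ) (x : H) :
    twist χ U (Multiplicative.ofAdd γ) x = (χ γ : ℂ) • U (Multiplicative.ofAdd γ) x := rfl

theorem IsInvariantMean.isMean {ν : LInf Γ →ₗ[ℂ] ℂ} (hν : IsInvariantMean ν) : IsMean ν := hν.1

theorem IsFSMean.isMean {η : LInf Γ →ₗ[ℂ] ℂ} (hη : IsFSMean η) : IsMean η := hη.1

theorem IsInvariantMean.map_charInf {ν : LInf Γ →ₗ[ℂ] ℂ} (hν : IsInvariantMean ν)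
    {χ : AddChar Γ Circle} (h : χ ≠ 1) : ν (charInf χ) = 0 := by
  obtain ⟨γ, hγ⟩ := AddChar.exists_apply_ne_one h
  have h1 : LInf.translate (-γ) (charInf χ) = (χ γ : ℂ) • charInf χ := by
    ext x
    simp [AddChar.map_add_eq_mul, mul_comm]
  have h2 := hν.2 (-γ) (charInf χ)
  rw [h1, map_smul, smul_eq_mul] at h2
  by_contra h0
  exact hγ (Circle.ext (mul_right_cancel₀ h0 (by simpa using h2)))

/-- The FS property is applied to the trivial action twisted by `χ`, which has no nonzero invariant
vector. Any Hilbert space in the right universe with a unit vector would do; the one of `η` with the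
class of `1` is at hand. -/
theorem IsFSMean.map_charInf {η : LInf Γ →ₗ[ℂ] ℂ} (hη : IsFSMean η)
    {χ : AddChar Γ Circle} (h : χ ≠ 1) : η (charInf χ) = 0 := by
  obtain ⟨γ, hγ⟩ := AddChar.exists_apply_ne_one h
  set v : MeanL2 hη.isMean := toL2 hη.isMean 1
  have hv : inner ℂ v v = 1 := by
    rw [inner_toL2, ← hη.isMean.1]
    congr 1
    ext x
    simp
  have h1 := hη.2 (MeanL2 hη.isMean) (twist χ 1) v v
  have h2 : matrixCoeff (twist χ (1 : Multiplicative Γ →* (MeanL2 hη.isMean ≃ₗᵢ[ℂ] MeanL2 hη.isMean))) v v =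
      star (charInf χ) := by
    ext x
    rw [matrixCoeff_apply, twist_apply, inner_smul_left]
    change _ * inner ℂ v v = _
    rw [hv, mul_one]
    rfl
  set p := (invariantSubspace (twist χ (1 : Multiplicative Γ →*
    (MeanL2 hη.isMean ≃ₗᵢ[ℂ] MeanL2 hη.isMean)))).starProjection v
  have h3 : (χ γ : ℂ) • p = p :=
    (Submodule.starProjection_apply_mem _ _ : p ∈ invariantSubspace (twist χ 1)) γ
  have h4 : p = 0 := by
    have : ((χ γ : ℂ) - 1) • p = 0 := by rw [sub_smul, h3, one_smul, sub_self]
    refine (smul_eq_zero.1 this).resolve_left fun h0 => hγ (Circle.ext ?_)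
    rw [sub_eq_zero.1 h0, Circle.coe_one]
  rw [h2, h4, inner_zero_left, hη.isMean.map_star] at h1
  exact star_eq_zero.1 h1

/-- The class of a character in the Hilbert space of a mean. -/
def charL2 {m : LInf Γ →ₗ[ℂ] ℂ} (hm : IsMean m) (χ : AddChar Γ Circle) : MeanL2 hm :=
  toL2 hm (charInf χ)

theorem inner_charL2 {m : LInf Γ →ₗ[ℂ] ℂ} (hm : IsMean m) (χ : AddChar Γ Circle) (f : LInf Γ) :
    inner ℂ (charL2 hm χ) (toL2 hm f) = meanFourierCoeff m f χ := by
  rw [charL2, inner_toL2, meanFourierCoeff, mul_comm]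

theorem orthonormal_charL2 {m : LInf Γ →ₗ[ℂ] ℂ} (hm : IsMean m)
    (h : ∀ χ : AddChar Γ Circle, χ ≠ 1 → m (charInf χ) = 0) : Orthonormal ℂ (charL2 hm) := by
  classical
  rw [orthonormal_iff_ite]
  intro χ ψ
  rw [charL2, charL2, inner_toL2, ← charInf_inv, ← charInf_mul]
  split_ifs with hχ
  · rw [hχ, inv_mul_cancel, charInf_one, hm.1]
  · exact h _ fun h1 => hχ (inv_mul_eq_one.1 h1)

theorem summable_sq_meanFourierCoeff {m : LInf Γ →ₗ[ℂ] ℂ} (hm : IsMean m)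
    (h : ∀ χ : AddChar Γ Circle, χ ≠ 1 → m (charInf χ) = 0) (f : LInf Γ) :
    Summable fun χ => ‖meanFourierCoeff m f χ‖ ^ 2 := by
  simpa only [inner_charL2] using (orthonormal_charL2 hm h).inner_products_summable (toL2 hm f)

/-! ### The regular representation of an invariant mean -/

section Regular

variable {ν : LInf Γ →ₗ[ℂ] ℂ}

/-- Translation, as a linear isometry for the semi-inner product of an invariant mean. -/
def translateIsometry (hν : IsInvariantMean ν) (γ : Γ) : PreL2 hν.isMean ≃ₗᵢ[ℂ] PreL2 hν.isMean :=
  LinearEquiv.isometryOfInner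
    ({ toFun f := toPreL2 hν.isMean (LInf.translate γ ((toPreL2 hν.isMean).symm f))
       invFun f := toPreL2 hν.isMean (LInf.translate (-γ) ((toPreL2 hν.isMean).symm f))
       map_add' f g := rfl
       map_smul' c f := rfl
       left_inv f := LInf.ext fun x => by
        change (toPreL2 hν.isMean).symm f (x - -γ - γ) = (toPreL2 hν.isMean).symm f x
        rw [show x - -γ - γ = x by abel]
       right_inv f := LInf.ext fun x => by
        change (toPreL2 hν.isMean).symm f (x - γ - -γ) = (toPreL2 hν.isMean).symm f x
        rw [show x - γ - -γ = x by abel] } : PreL2 hν.isMean ≃ₗ[ℂ] PreL2 hν.isMean)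
    fun f g => hν.2 γ (star ((toPreL2 hν.isMean).symm f) * (toPreL2 hν.isMean).symm g)

/-- The action of `Γ` by translations on the Hilbert space of an invariant mean. -/
def regularAction (hν : IsInvariantMean ν) :
    Multiplicative Γ →* (MeanL2 hν.isMean ≃ₗᵢ[ℂ] MeanL2 hν.isMean) :=
  completionAction
    { toFun g := translateIsometry hν g.toAdd
      map_one' := LinearIsometryEquiv.ext fun f => LInf.ext fun x => by
        change (toPreL2 hν.isMean).symm f (x - 0) = (toPreL2 hν.isMean).symm f x
        rw [sub_zero]
      map_mul' g h := LinearIsometryEquiv.ext fun f => LInf.ext fun x => by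
        change (toPreL2 hν.isMean).symm f (x - (g.toAdd + h.toAdd)) =
          (toPreL2 hν.isMean).symm f (x - g.toAdd - h.toAdd)
        rw [sub_sub] }

theorem regularAction_toL2 (hν : IsInvariantMean ν) (γ : Γ) (f : LInf Γ) :
    regularAction hν (Multiplicative.ofAdd γ) (toL2 hν.isMean f) = toL2 hν.isMean (LInf.translate γ f) :=
  completionAction_coe _ _ _

theorem regularAction_charL2 (hν : IsInvariantMean ν) (γ : Γ) (χ : AddChar Γ Circle) :
    regularAction hν (Multiplicative.ofAdd γ) (charL2 hν.isMean χ) =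
      (starRingEnd ℂ) (χ γ : ℂ) • charL2 hν.isMean χ := by
  rw [charL2, regularAction_toL2, ← map_smul]
  congr 1
  ext x
  rw [LInf.translate_apply, LInf.smul_apply, charInf_apply, charInf_apply, sub_eq_add_neg,
    AddChar.map_add_eq_mul, AddChar.map_neg_eq_inv, Circle.coe_mul, Circle.coe_inv_eq_conj,
    mul_comm]

/-- The correlation `γ ↦ ν(k · f_γ)`. -/
def correlation (hν : IsInvariantMean ν) (k f : LInf Γ) : LInf Γ :=
  matrixCoeff (regularAction hν) (toL2 hν.isMean k) (toL2 hν.isMean (star f))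

/-- The conjugate on `f` in the matrix coefficient cancels the one in the first slot of the inner
product. -/
theorem correlation_apply (hν : IsInvariantMean ν) (k f : LInf Γ) (γ : Γ) :
    correlation hν k f γ = ν (k * LInf.translate γ f) := by
  rw [correlation, matrixCoeff_apply, regularAction_toL2, inner_toL2]
  congr 1
  ext x
  simp [mul_comm]

variable {η : LInf Γ →ₗ[ℂ] ℂ}

/-- The functional `k ↦ η(γ ↦ ν(k · f_γ))`. -/
def correlationMean (hν : IsInvariantMean ν) (η : LInf Γ →ₗ[ℂ] ℂ) (f : LInf Γ) :
    LInf Γ →ₗ[ℂ] ℂ where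
  toFun k := η (correlation hν k f)
  map_add' k l := by
    rw [← map_add]
    congr 1
    ext γ
    simp [correlation_apply, add_mul]
  map_smul' c k := by
    rw [RingHom.id_apply, ← map_smul]
    congr 1
    ext γ
    simp [correlation_apply, smul_mul_assoc]

theorem correlationMean_apply (hν : IsInvariantMean ν) (f k : LInf Γ) :
    correlationMean hν η f k = η (correlation hν k f) := rfl

theorem correlationMean_add (hν : IsInvariantMean ν) (f g : LInf Γ) :
    correlationMean hν η (f + g) = correlationMean hν η f + correlationMean hν η g := by
  ext k
  rw [LinearMap.add_apply, correlationMean_apply, correlationMean_apply, correlationMean_apply,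
    ← map_add]
  congr 1
  ext γ
  rw [LInf.add_apply, correlation_apply, correlation_apply, correlation_apply, ← map_add,
    ← mul_add]
  rfl

theorem correlationMean_smul (hν : IsInvariantMean ν) (c : ℂ) (f : LInf Γ) :
    correlationMean hν η (c • f) = c • correlationMean hν η f := by
  ext k
  rw [LinearMap.smul_apply, correlationMean_apply, correlationMean_apply, ← map_smul]
  congr 1
  ext γ
  rw [LInf.smul_apply, correlation_apply, correlation_apply, ← smul_eq_mul c, ← map_smul]
  congr 1
  ext x
  simp [mul_left_comm]

theorem correlationMean_one (hν : IsInvariantMean ν) (hη : IsMean η) :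
    correlationMean hν η 1 = ν := by
  ext k
  refine hη.map_const fun γ => ?_
  rw [correlation_apply]
  congr 1
  ext x
  simp

theorem correlationMean_apply_one (hν : IsInvariantMean ν) (hη : IsMean η) (f : LInf Γ) :
    correlationMean hν η f 1 = ν f := by
  refine hη.map_const fun γ => ?_
  rw [correlation_apply, one_mul, hν.2]

/-- Although `η` need not be invariant, the FS property turns the functional into a pairing with a
translation-invariant vector. -/
theorem correlationMean_translate (hν : IsInvariantMean ν) (hη : IsFSMean η) (f : LInf Γ) (γ : Γ)
    (k : LInf Γ) :
    correlationMean hν η f (LInf.translate γ k) = correlationMean hν η f k := by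
  rw [correlationMean_apply, correlationMean_apply, correlation, correlation, hη.2, hη.2,
    ← regularAction_toL2]
  set p := (invariantSubspace (regularAction hν)).starProjection (toL2 hν.isMean (star f))
  have hp : regularAction hν (Multiplicative.ofAdd γ) p = p :=
    (Submodule.starProjection_apply_mem _ _ : p ∈ invariantSubspace (regularAction hν)) γ
  conv_lhs => rw [← hp]
  exact LinearIsometryEquiv.inner_map_map _ _ _

theorem correlationMean_nonneg (hν : IsInvariantMean ν) (hη : IsMean η) {f : LInf Γ}
    (hf : ∀ x, (f x).im = 0 ∧ 0 ≤ (f x).re) {k : LInf Γ} (hk : ∀ x, (k x).im = 0 ∧ 0 ≤ (k x).re) :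
    (correlationMean hν η f k).im = 0 ∧ 0 ≤ (correlationMean hν η f k).re := by
  refine hη.2 _ fun γ => ?_
  rw [correlation_apply]
  refine hν.isMean.2 _ fun x => ?_
  rw [LInf.mul_apply, LInf.translate_apply, Complex.mul_im, Complex.mul_re, (hk x).1,
    (hf (x - γ)).1]
  simpa using mul_nonneg (hk x).2 (hf (x - γ)).2

theorem isInvariantMean_smul_correlationMean (hν : IsInvariantMean ν) (hη : IsFSMean η)
    {f : LInf Γ} (hf : ∀ x, (f x).im = 0 ∧ 0 ≤ (f x).re) {c : ℝ} (hc : 0 < c) (hνf : ν f = c) :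
    IsInvariantMean (c⁻¹ • correlationMean hν η f) := by
  refine ⟨⟨?_, fun k hk => ?_⟩, fun γ k => ?_⟩
  · rw [LinearMap.smul_apply, correlationMean_apply_one hν hη.isMean, hνf, Complex.real_smul,
      Complex.ofReal_inv, inv_mul_cancel₀ (by exact_mod_cast hc.ne')]
  · obtain ⟨h1, h2⟩ := correlationMean_nonneg hν hη.isMean hf hk
    rw [LinearMap.smul_apply, Complex.smul_im, Complex.smul_re, h1]
    exact ⟨by simp, smul_nonneg (inv_nonneg.2 hc.le) h2⟩
  · rw [LinearMap.smul_apply, LinearMap.smul_apply, correlationMean_translate hν hη]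

theorem IsExtremeInvariantMean.isInvariantMean (hν : IsExtremeInvariantMean ν) :
    IsInvariantMean ν :=
  (extremePoints_subset hν : ν ∈ {m | IsInvariantMean m})

theorem IsExtremeInvariantMean.correlationMean_eq_of_pos (hν : IsExtremeInvariantMean ν)
    (hi : IsInvariantMean ν) (hη : IsFSMean η) {f : LInf Γ} (him : ∀ x, (f x).im = 0)
    (hf : ∀ x, 1 / 4 ≤ (f x).re ∧ (f x).re ≤ 3 / 4) :
    correlationMean hi η f = ν f • ν := by
  obtain ⟨c, hc⟩ : ∃ c : ℝ, ν f = c :=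
    ⟨(ν f).re, Complex.ext rfl (by simpa using hi.isMean.im_eq_zero him)⟩
  have h1 : (ν (((1 / 4 : ℝ) : ℂ) • 1)).re ≤ (ν f).re :=
    hi.isMean.re_mono (by simp) him fun x => by simpa using (hf x).1
  have h2 : (ν f).re ≤ (ν (((3 / 4 : ℝ) : ℂ) • 1)).re :=
    hi.isMean.re_mono him (by simp) fun x => by simpa using (hf x).2
  rw [map_smul, hi.isMean.1, hc, smul_eq_mul, mul_one, Complex.ofReal_re, Complex.ofReal_re] at h1 h2
  have hc0 : 0 < c := by linarith
  have hc1 : 0 < 1 - c := by linarith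
  have ha := isInvariantMean_smul_correlationMean hi hη (f := f)
    (fun x => ⟨him x, by linarith [(hf x).1]⟩) hc0 hc
  have hb := isInvariantMean_smul_correlationMean hi hη (f := 1 - f) (c := 1 - c)
    (fun x => ⟨by simp [him x], by simpa using (hf x).2.trans (by norm_num)⟩) hc1
    (by rw [map_sub, hi.isMean.1, hc]; simp)
  -- The functionals of `f` and `1 - f` add up to that of `1`, which is `ν`. After normalization
  -- this is a proper convex combination of invariant means, so extremality makes them equal to `ν`.
  have hseg : ν ∈ openSegment ℝ (c⁻¹ • correlationMean hi η f)
      ((1 - c)⁻¹ • correlationMean hi η (1 - f)) := by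
    refine ⟨c, 1 - c, hc0, hc1, by ring, ?_⟩
    rw [smul_smul, smul_smul, mul_inv_cancel₀ hc0.ne', mul_inv_cancel₀ hc1.ne', one_smul, one_smul,
      ← correlationMean_add, add_sub_cancel, correlationMean_one hi hη.isMean]
  have h := hν.2 ha hb hseg
  ext k
  have hk := congrArg (fun T : LInf Γ →ₗ[ℂ] ℂ => T k) h
  simp only [LinearMap.smul_apply, Complex.real_smul, Complex.ofReal_inv] at hk
  rw [LinearMap.smul_apply, smul_eq_mul, ← hk, hc,
    mul_inv_cancel_left₀ (by exact_mod_cast hc0.ne')]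

theorem IsExtremeInvariantMean.correlationMean_eq_of_real (hν : IsExtremeInvariantMean ν)
    (hi : IsInvariantMean ν) (hη : IsFSMean η) {f : LInf Γ} (him : ∀ x, (f x).im = 0) :
    correlationMean hi η f = ν f • ν := by
  -- Chosen so that `1/2 + t f` lies in `[1/4, 3/4]`; the `+ 1` covers `f = 0`.
  set t : ℝ := (4 * (‖f‖ + 1))⁻¹
  have ht : 0 < t := by positivity
  have hbound : ∀ x, |t * (f x).re| ≤ 1 / 4 := fun x => by
    rw [abs_mul, abs_of_pos ht]
    have h1 := (Complex.abs_re_le_norm (f x)).trans (f.norm_apply_le x)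
    calc t * |(f x).re| ≤ t * (‖f‖ + 1) := by gcongr; linarith
      _ = 1 / 4 := by
        simp only [t]
        have := norm_nonneg f
        field_simp
  have h := hν.correlationMean_eq_of_pos hi hη (f := ((1 / 2 : ℝ) : ℂ) • 1 + (t : ℂ) • f)
    (fun x => by
      rw [LInf.add_apply, LInf.smul_apply, LInf.smul_apply, LInf.one_apply]
      simp [him x])
    (fun x => by
      have := abs_le.1 (hbound x)
      rw [LInf.add_apply, LInf.smul_apply, LInf.smul_apply, LInf.one_apply, mul_one, Complex.add_re,
        Complex.ofReal_re, Complex.re_ofReal_mul]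
      constructor <;> linarith)
  rw [correlationMean_add, correlationMean_smul, correlationMean_smul, correlationMean_one hi hη.isMean,
    map_add, map_smul, map_smul, hi.isMean.1, smul_eq_mul, smul_eq_mul, mul_one, add_smul,
    add_right_inj, mul_smul] at h
  exact smul_right_injective _ (by exact_mod_cast ht.ne' : (t : ℂ) ≠ 0) h

theorem IsExtremeInvariantMean.correlationMean_eq (hν : IsExtremeInvariantMean ν)
    (hi : IsInvariantMean ν) (hη : IsFSMean η) (f : LInf Γ) :
    correlationMean hi η f = ν f • ν := by
  have hdecomp : f = (1 / 2 : ℂ) • (f + star f) +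
      (-(Complex.I / 2)) • (Complex.I • (f - star f)) := by
    ext x
    simp only [LInf.add_apply, LInf.smul_apply, LInf.sub_apply, LInf.star_apply, RCLike.star_def]
    linear_combination (1 / 2 * (f x - (starRingEnd ℂ) (f x))) * Complex.I_sq
  have h1 := hν.correlationMean_eq_of_real hi hη (f := f + star f) (by simp)
  have h2 := hν.correlationMean_eq_of_real hi hη (f := Complex.I • (f - star f)) (by simp)
  rw [hdecomp, correlationMean_add, correlationMean_smul, correlationMean_smul, h1, h2, smul_smul,
    smul_smul, ← add_smul, map_add ν (_ • _), map_smul ν (1 / 2 : ℂ), map_smul ν (-(Complex.I / 2)),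
    smul_eq_mul, smul_eq_mul]

/-! ### Eigenvectors of the regular representation -/

/-- Twisting by `χ` makes `w` invariant. The factorization of correlation means shows that the
projection onto the twisted invariants sends each bounded function to a multiple of `χ`; so `w`,
orthogonal to `χ`, is orthogonal to a dense set. -/
theorem IsExtremeInvariantMean.eq_zero_of_eigenvector (hν : IsExtremeInvariantMean ν)
    (hi : IsInvariantMean ν) (hη : IsFSMean η) (χ : AddChar Γ Circle) {w : MeanL2 hi.isMean}
    (hw : ∀ γ, regularAction hi (Multiplicative.ofAdd γ) w =
      (starRingEnd ℂ) (χ γ : ℂ) • w)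
    (hw0 : inner ℂ (charL2 hi.isMean χ) w = 0) : w = 0 := by
  set U := twist χ (regularAction hi)
  have hwU : w ∈ invariantSubspace U := fun γ => by
    rw [twist_apply, hw, smul_smul, mul_comm, star_mul_self_char, one_smul]
  have key : ∀ f : LInf Γ, (invariantSubspace U).starProjection (toL2 hi.isMean f) =
      meanFourierCoeff ν f χ • charL2 hi.isMean χ := fun f => by
    refine ext_inner_toL2 hi.isMean fun k => ?_
    rw [← inner_conj_symm, ← inner_conj_symm (toL2 hi.isMean k)]
    congr 1
    rw [← hη.2]
    have h1 : matrixCoeff U (toL2 hi.isMean k) (toL2 hi.isMean f) =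
        correlation hi (star (charInf χ) * k) (star f * charInf χ) := by
      ext γ
      rw [matrixCoeff_apply, twist_apply, inner_smul_left, regularAction_toL2, inner_toL2,
        correlation_apply, ← smul_eq_mul, ← map_smul]
      congr 1
      ext x
      have h2 : (χ x : ℂ) = χ (x - γ) * χ γ := by
        rw [← Circle.coe_mul, ← AddChar.map_add_eq_mul, sub_add_cancel]
      simp only [LInf.smul_apply, LInf.mul_apply, LInf.star_apply, LInf.translate_apply,
        charInf_apply, RCLike.star_def, h2, map_mul]
      linear_combination -((starRingEnd ℂ) (χ γ : ℂ) * (starRingEnd ℂ) (f (x - γ)) * k x) *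
        star_mul_self_char χ (x - γ)
    rw [h1, ← correlationMean_apply, hν.correlationMean_eq hi hη, LinearMap.smul_apply,
      inner_smul_left, charL2, inner_toL2, meanFourierCoeff, smul_eq_mul]
    congr 1
    change _ = star _
    rw [← hi.isMean.map_star]
    congr 1
    ext x
    simp
  have horth : ∀ f : LInf Γ, inner ℂ (toL2 hi.isMean f) w = 0 := fun f => by
    have h1 := Submodule.inner_starProjection_left_eq_right (invariantSubspace U) (toL2 hi.isMean f) w
    rw [key, Submodule.starProjection_eq_self_iff.2 hwU, inner_smul_left, hw0, mul_zero] at h1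
    exact h1.symm
  exact ext_inner_toL2 hi.isMean fun k => by rw [horth, inner_zero_right]

/-- The eigenvalues are unimodular and multiplicative. The conjugate matches the convention that
translation acts on `χ` by `conj χ(γ)`. -/
theorem exists_char_of_eigenvector {H : Type*} [NormedAddCommGroup H] [InnerProductSpace ℂ H]
    (U : Multiplicative Γ →* (H ≃ₗᵢ[ℂ] H)) {w : H} (hw0 : w ≠ 0) {c : Multiplicative Γ → ℂ}
    (hw : ∀ g, U g w = c g • w) :
    ∃ χ : AddChar Γ Circle, ∀ γ, c (Multiplicative.ofAdd γ) = (starRingEnd ℂ) (χ γ : ℂ) := by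
  have hnorm : ∀ g, ‖c g‖ = 1 := fun g => by
    have h1 := (U g).norm_map w
    rw [hw, norm_smul] at h1
    exact mul_right_cancel₀ (norm_ne_zero_iff.2 hw0) (h1.trans (one_mul _).symm)
  have hone : c 1 = 1 := smul_left_injective ℂ hw0 (by
    change c 1 • w = (1 : ℂ) • w
    rw [← hw, map_one, one_smul]
    rfl)
  have hmul : ∀ g h, c (g * h) = c g * c h := fun g h => smul_left_injective ℂ hw0 (by
    change c (g * h) • w = (c g * c h) • w
    rw [← hw, map_mul, isometry_mul_apply, hw, map_smul, hw, smul_smul, mul_comm])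
  refine ⟨{ toFun γ := ⟨(starRingEnd ℂ) (c (Multiplicative.ofAdd γ)),
              mem_sphere_zero_iff_norm.2 (by rw [RCLike.norm_conj, hnorm])⟩
            map_zero_eq_one' := Circle.ext (by
              change (starRingEnd ℂ) (c 1) = 1
              rw [hone, map_one])
            map_add_eq_mul' γ δ := Circle.ext (by
              change (starRingEnd ℂ) (c (Multiplicative.ofAdd γ * Multiplicative.ofAdd δ)) =
                (starRingEnd ℂ) (c (Multiplicative.ofAdd γ)) *
                  (starRingEnd ℂ) (c (Multiplicative.ofAdd δ))
              rw [hmul, map_mul]) }, fun γ => ?_⟩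
  exact (Complex.conj_conj _).symm

theorem IsExtremeInvariantMean.inner_eigenvector_eq_zero (hν : IsExtremeInvariantMean ν)
    (hi : IsInvariantMean ν) (hη : IsFSMean η) {v : MeanL2 hi.isMean}
    (hv : ∀ χ, inner ℂ (charL2 hi.isMean χ) v = 0)
    (w : MeanL2 hi.isMean) (c : Multiplicative Γ → ℂ)
    (hw : ∀ g, regularAction hi g w = c g • w) : inner ℂ w v = 0 := by
  rcases eq_or_ne w 0 with rfl | hw0
  · exact inner_zero_left _
  obtain ⟨χ, hχ⟩ := exists_char_of_eigenvector (regularAction hi) hw0 hw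
  have h1 : inner ℂ (charL2 hi.isMean χ) (charL2 hi.isMean χ) = 1 := by
    rw [inner_self_eq_norm_sq_to_K, (orthonormal_charL2 hi.isMean fun _ => hi.map_charInf).1]
    simp
  have h2 : w - (inner ℂ (charL2 hi.isMean χ) w : ℂ) • charL2 hi.isMean χ = 0 := by
    refine hν.eq_zero_of_eigenvector hi hη χ (fun γ => ?_) ?_
    · rw [map_sub, map_smul, hw, hχ, regularAction_charL2, smul_sub, smul_comm]
    · rw [inner_sub_right, inner_smul_right, h1, mul_one, sub_self]
  rw [sub_eq_zero.1 h2, inner_smul_left, hv, mul_zero]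

/-- Polarization reduces to diagonal coefficients of vectors orthogonal to the characters; these are
null for `η`, and Cauchy–Schwarz absorbs `g`. -/
theorem IsExtremeInvariantMean.map_mul_matrixCoeff_eq_zero (hν : IsExtremeInvariantMean ν)
    (hi : IsInvariantMean ν) (hη : IsFSMean η) {u v : MeanL2 hi.isMean}
    (hu : ∀ χ, inner ℂ (charL2 hi.isMean χ) u = 0)
    (hv : ∀ χ, inner ℂ (charL2 hi.isMean χ) v = 0) (g : LInf Γ) :
    η (g * matrixCoeff (regularAction hi) u v) = 0 := by
  set U := regularAction hi
  have key : ∀ x, (∀ χ, inner ℂ (charL2 hi.isMean χ) x = 0) →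
      η (g * matrixCoeff U x x) = 0 := fun x hx =>
    hη.isMean.map_mul_eq_zero
      (hη.map_sq_matrixCoeff_self U x (hν.inner_eigenvector_eq_zero hi hη hx)) g
  have hpol : matrixCoeff U u v = (1 / 4 : ℂ) • (matrixCoeff U (u + v) (u + v) -
      matrixCoeff U (u - v) (u - v) +
      Complex.I • matrixCoeff U (u + Complex.I • v) (u + Complex.I • v) -
      Complex.I • matrixCoeff U (u - Complex.I • v) (u - Complex.I • v)) := by
    ext γ
    have := inner_map_polarization
      (((U (Multiplicative.ofAdd γ)).toLinearEquiv : MeanL2 hi.isMean →ₗ[ℂ] _)) u v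
    rw [LInf.smul_apply, LInf.sub_apply, LInf.add_apply, LInf.sub_apply, LInf.smul_apply,
      LInf.smul_apply]
    simp only [matrixCoeff_apply]
    refine this.trans ?_
    rw [div_eq_inv_mul, one_div]
    rfl
  have h1 := key (u + v) fun χ => by rw [inner_add_right, hu, hv, add_zero]
  have h2 := key (u - v) fun χ => by rw [inner_sub_right, hu, hv, sub_zero]
  have h3 := key (u + Complex.I • v) fun χ => by
    rw [inner_add_right, inner_smul_right, hu, hv, mul_zero, add_zero]
  have h4 := key (u - Complex.I • v) fun χ => by
    rw [inner_sub_right, inner_smul_right, hu, hv, mul_zero, sub_zero]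
  rw [hpol, mul_smul_comm, map_smul, mul_sub, mul_add, mul_sub, mul_smul_comm, mul_smul_comm,
    map_sub, map_add, map_sub, map_smul, map_smul, h1, h2, h3, h4]
  simp

end Regular

end

end DiscreteMeans

/-! ### Fourier expansion of averaged correlations and the sumset -/

namespace DiscreteMeans

universe u

open UniformSpace

noncomputable section

/-! ### Series along orthonormal families -/

theorem summable_smul_of_orthonormal {ι H : Type*} [NormedAddCommGroup H] [InnerProductSpace ℂ H]
    [CompleteSpace H] {e : ι → H} (he : Orthonormal ℂ e) {c : ι → ℂ}
    (hc : Summable fun i => ‖c i‖ ^ 2) : Summable fun i => c i • e i :=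
  (he.orthogonalFamily.summable_iff_norm_sq_summable c).2 hc

theorem inner_eq_of_hasSum_smul {ι H : Type*} [NormedAddCommGroup H] [InnerProductSpace ℂ H]
    {e : ι → H} (he : Orthonormal ℂ e) {c : ι → ℂ} {x : H} (hx : HasSum (fun i => c i • e i) x)
    (j : ι) : inner ℂ (e j) x = c j := by
  classical
  have h1 : HasSum (fun i => inner ℂ (e j) (c i • e i)) (inner ℂ (e j) x) :=
    hx.mapL (innerSL ℂ (e j))
  have h2 : (fun i => inner ℂ (e j) (c i • e i)) = fun i => if i = j then c j else 0 := by
    ext i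
    rw [inner_smul_right, orthonormal_iff_ite.1 he]
    by_cases h : i = j
    · simp [h]
    · simp [h, Ne.symm h]
  rw [h2] at h1
  exact h1.unique (hasSum_ite_eq j (c j))

theorem summable_mul_of_summable_sq {ι : Type*} {a b : ι → ℂ} (ha : Summable fun i => ‖a i‖ ^ 2)
    (hb : Summable fun i => ‖b i‖ ^ 2) : Summable fun i => ‖a i * b i‖ := by
  refine .of_nonneg_of_le (fun i => norm_nonneg _) (fun i => ?_) (ha.add hb)
  rw [norm_mul]
  nlinarith [sq_nonneg (‖a i‖ - ‖b i‖), sq_nonneg (‖a i‖ + ‖b i‖)]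

variable {Γ : Type u} [AddCommGroup Γ]

theorem summable_smul_charInf {c : AddChar Γ Circle → ℂ} (hc : Summable fun χ => ‖c χ‖) :
    Summable fun χ => c χ • charInf χ := by
  refine .of_norm_bounded hc fun χ => ?_
  rw [norm_smul]
  exact mul_le_of_le_one_right (norm_nonneg _) (norm_charInf_le χ)

theorem LInf.hasSum_apply {X : Type u} {ι : Type*} {f : ι → LInf X} {s : LInf X}
    (h : HasSum f s) (x : X) : HasSum (fun i => f i x) (s x) :=
  h.mapL (lp.evalCLM (p := ∞) (𝕜 := ℂ) (fun _ : X => ℂ) x)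

/-! ### Averages of correlations against a bounded function -/

theorem matrixCoeff_add_left {H : Type*} [NormedAddCommGroup H] [InnerProductSpace ℂ H]
    (U : Multiplicative Γ →* (H ≃ₗᵢ[ℂ] H)) (u u' v : H) :
    matrixCoeff U (u + u') v = matrixCoeff U u v + matrixCoeff U u' v :=
  LInf.ext fun _ => inner_add_right _ _ _

theorem matrixCoeff_add_right {H : Type*} [NormedAddCommGroup H] [InnerProductSpace ℂ H]
    (U : Multiplicative Γ →* (H ≃ₗᵢ[ℂ] H)) (u v v' : H) :
    matrixCoeff U u (v + v') = matrixCoeff U u v + matrixCoeff U u v' :=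
  LInf.ext fun γ => by
    change inner ℂ (U (Multiplicative.ofAdd γ) (v + v')) u =
      inner ℂ (U (Multiplicative.ofAdd γ) v) u + inner ℂ (U (Multiplicative.ofAdd γ) v') u
    rw [map_add, inner_add_left]

variable {ν η : LInf Γ →ₗ[ℂ] ℂ}

theorem exists_char_decomposition (hi : IsInvariantMean ν) (v : MeanL2 hi.isMean) :
    ∃ v₁ v₂, v = v₁ + v₂ ∧
      HasSum (fun χ => (inner ℂ (charL2 hi.isMean χ) v : ℂ) • charL2 hi.isMean χ) v₁ ∧
      ∀ χ, inner ℂ (charL2 hi.isMean χ) v₂ = 0 := by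
  have he := orthonormal_charL2 hi.isMean fun _ => hi.map_charInf
  have hs := (summable_smul_of_orthonormal he (he.inner_products_summable v)).hasSum
  refine ⟨_, v - _, (add_sub_cancel _ v).symm, hs, fun χ => ?_⟩
  rw [inner_sub_right, inner_eq_of_hasSum_smul he hs, sub_self]

/-- Characters are eigenvectors of translation, so their orthogonal complement is
translation-invariant. -/
theorem matrixCoeff_eq_zero_of_orthogonal (hi : IsInvariantMean ν) {u v : MeanL2 hi.isMean}
    {c : AddChar Γ Circle → ℂ} (hu : HasSum (fun χ => c χ • charL2 hi.isMean χ) u)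
    (hv : ∀ χ, inner ℂ (charL2 hi.isMean χ) v = 0) :
    matrixCoeff (regularAction hi) u v = 0 := by
  ext γ
  rw [matrixCoeff_apply]
  set T := regularAction hi (Multiplicative.ofAdd γ)
  have h0 : ∀ χ, inner ℂ (T v) (charL2 hi.isMean χ) = 0 := fun χ => by
    have h1 : charL2 hi.isMean χ = (χ γ : ℂ) • T (charL2 hi.isMean χ) := by
      rw [regularAction_charL2, smul_smul, mul_comm, star_mul_self_char, one_smul]
    rw [h1, inner_smul_right, LinearIsometryEquiv.inner_map_map, inner_eq_zero_symm.1 (hv χ),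
      mul_zero]
  refine (hu.mapL (innerSL ℂ (T v))).unique ?_
  simp only [innerSL_apply_apply, inner_smul_right, h0, mul_zero]
  exact hasSum_zero

/-- Absolute summability gives convergence in sup norm, which `η` can be applied to termwise; the
limit is identified pointwise. -/
theorem hasSum_matrixCoeff (hi : IsInvariantMean ν) {u v : MeanL2 hi.isMean}
    {a : AddChar Γ Circle → ℂ} (hv : HasSum (fun χ => a χ • charL2 hi.isMean χ) v)
    (hs : Summable fun χ => ‖(starRingEnd ℂ) (a χ) * inner ℂ (charL2 hi.isMean χ) u‖) :
    HasSum (fun χ => ((starRingEnd ℂ) (a χ) * inner ℂ (charL2 hi.isMean χ) u) • charInf χ)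
      (matrixCoeff (regularAction hi) u v) := by
  convert (summable_smul_charInf hs).hasSum
  ext γ
  refine HasSum.unique ?_ (LInf.hasSum_apply (summable_smul_charInf hs).hasSum γ)
  set T := regularAction hi (Multiplicative.ofAdd γ) with hT
  have h1 : HasSum (fun χ => (starRingEnd ℂ) (inner ℂ u (T (a χ • charL2 hi.isMean χ))))
      ((starRingEnd ℂ) (inner ℂ u (T v))) :=
    ((hv.mapL (T : MeanL2 hi.isMean →L[ℂ] MeanL2 hi.isMean)).mapL (innerSL ℂ u)).star
  simp only [inner_conj_symm, map_smul, hT, regularAction_charL2, inner_smul_left,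
    Complex.conj_conj] at h1
  rw [matrixCoeff_apply]
  have h2 : (fun χ => (((starRingEnd ℂ) (a χ) * inner ℂ (charL2 hi.isMean χ) u) • charInf χ) γ) =
      fun χ => (starRingEnd ℂ) (a χ) * ((χ γ : ℂ) * inner ℂ (charL2 hi.isMean χ) u) := by
    ext χ
    rw [LInf.smul_apply, charInf_apply]
    ring
  rw [h2]
  exact h1

theorem IsExtremeInvariantMean.hasSum_correlation (hν : IsExtremeInvariantMean ν)
    (hi : IsInvariantMean ν) (hη : IsFSMean η) (f g k : LInf Γ) :
    HasSum (fun χ => meanFourierCoeff ν f χ * meanFourierCoeff η g χ * ν (k * charInf χ))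
      (η (g * correlation hi k f)) := by
  set U := regularAction hi
  have he := orthonormal_charL2 hi.isMean fun _ => hi.map_charInf
  obtain ⟨u₁, u₂, hu, hu₁, hu₂⟩ := exists_char_decomposition hi (toL2 hi.isMean k)
  obtain ⟨v₁, v₂, hv, hv₁, hv₂⟩ := exists_char_decomposition hi (toL2 hi.isMean (star f))
  have hcorr : η (g * correlation hi k f) = η (g * matrixCoeff U (toL2 hi.isMean k) v₁) := by
    have h2 : matrixCoeff U (toL2 hi.isMean k) v₂ = matrixCoeff U u₂ v₂ := by
      rw [hu, matrixCoeff_add_left, matrixCoeff_eq_zero_of_orthogonal hi hu₁ hv₂, zero_add]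
    rw [correlation, hv, matrixCoeff_add_right, mul_add, map_add, h2,
      hν.map_mul_matrixCoeff_eq_zero hi hη hu₂ hv₂, add_zero]
  have ha := he.inner_products_summable (toL2 hi.isMean (star f))
  have hb := he.inner_products_summable (toL2 hi.isMean k)
  have hs := hasSum_matrixCoeff hi (u := toL2 hi.isMean k) hv₁
    (summable_mul_of_summable_sq (by simpa only [RCLike.norm_conj] using ha) hb)
  have hs2 := (hs.mul_left g).map η hη.isMean.continuous
  -- The expansion is indexed by the eigencharacters `χ` of `conj f`, that is, by the inverses of
  -- the frequencies of `f`.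
  rw [hcorr, ← (Equiv.inv (AddChar Γ Circle)).hasSum_iff]
  convert hs2 using 1
  ext χ
  have h1 : meanFourierCoeff ν f χ⁻¹ =
      (starRingEnd ℂ) (inner ℂ (charL2 hi.isMean χ) (toL2 hi.isMean (star f))) := by
    rw [inner_charL2, meanFourierCoeff, meanFourierCoeff, charInf_inv, star_star]
    change _ = star _
    rw [← hi.isMean.map_star]
    congr 1
    ext x
    simp
  have h2 : ν (k * charInf χ⁻¹) = inner ℂ (charL2 hi.isMean χ) (toL2 hi.isMean k) := by
    rw [inner_charL2, meanFourierCoeff, charInf_inv]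
  have h3 : meanFourierCoeff η g χ⁻¹ = η (g * charInf χ) := by
    rw [meanFourierCoeff, charInf_inv, star_star]
  simp only [Function.comp_apply, Equiv.inv_apply]
  rw [h1, h2, h3, mul_smul_comm, map_smul, smul_eq_mul]
  ring

/-- For `γ ∈ B` the translate of `1_A` lives on `A + γ ⊆ A + B`, where `k` vanishes. -/
theorem correlation_mul_eq_zero (hi : IsInvariantMean ν) (A B : Set Γ) {k : LInf Γ}
    (hk : ∀ x ∈ A + B, k x = 0) : ind B * correlation hi k (ind A) = 0 := by
  ext γ
  change B.indicator 1 γ * correlation hi k (ind A) γ = 0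
  by_cases hγ : γ ∈ B
  · rw [correlation_apply]
    convert mul_zero _
    convert map_zero ν
    ext x
    change k x * A.indicator 1 (x - γ) = 0
    by_cases hx : x - γ ∈ A
    · rw [hk x (by simpa using Set.add_mem_add hx hγ), zero_mul]
    · rw [Set.indicator_of_notMem hx, mul_zero]
  · rw [Set.indicator_of_notMem hγ, zero_mul]

/-- The product of two Fourier series vanishes, up to a null set, outside the sumset. -/
theorem IsExtremeInvariantMean.map_mul_eq_zero_of_hasSum (hν : IsExtremeInvariantMean ν)
    (hη : IsFSMean η) (A B : Set Γ) {h k : LInf Γ}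
    (hh : HasSum (fun χ => (meanFourierCoeff ν (ind A) χ * meanFourierCoeff η (ind B) χ) •
      charInf χ) h) (hk : ∀ x ∈ A + B, k x = 0) : ν (k * h) = 0 := by
  have hi := hν.isInvariantMean
  have h1 := (hh.mul_left k).map ν hi.isMean.continuous
  refine h1.unique ?_
  have h2 := hν.hasSum_correlation hi hη (ind A) (ind B) k
  rw [correlation_mul_eq_zero hi A B hk, map_zero] at h2
  convert h2 using 1
  ext χ
  rw [Function.comp_apply, mul_smul_comm, map_smul, smul_eq_mul]

end

end DiscreteMeans

/-! ### Harmonic analysis on the Bohr compactification -/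

namespace DiscreteMeans

universe u

open MeasureTheory

noncomputable section

variable {Γ : Type u} [AddCommGroup Γ]

/-! ### Fourier analysis on the Bohr compactification -/

theorem Bohr.extend_apply (χ : AddChar Γ Circle) (x : Bohr Γ) :
    Bohr.extend χ x = (x.eval χ : ℂ) := rfl

theorem Bohr.extend_ofGroup (χ : AddChar Γ Circle) (γ : Γ) :
    Bohr.extend χ (Bohr.ofGroup γ) = (χ γ : ℂ) := rfl

theorem Bohr.eval_one (x : Bohr Γ) : x.eval 1 = 1 :=
  map_one (Additive.toMul (α := PontryaginDual (DiscreteDual Γ)) x :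
    PontryaginDual (DiscreteDual Γ))

theorem Bohr.eval_mul (x : Bohr Γ) (χ ψ : AddChar Γ Circle) :
    x.eval (χ * ψ) = x.eval χ * x.eval ψ :=
  map_mul (Additive.toMul (α := PontryaginDual (DiscreteDual Γ)) x :
    PontryaginDual (DiscreteDual Γ)) (χ : DiscreteDual Γ) (ψ : DiscreteDual Γ)

theorem Bohr.eval_inv (x : Bohr Γ) (χ : AddChar Γ Circle) : x.eval χ⁻¹ = (x.eval χ)⁻¹ :=
  eq_inv_of_mul_eq_one_left (by rw [← Bohr.eval_mul, inv_mul_cancel, Bohr.eval_one])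

theorem Bohr.eval_neg (x : Bohr Γ) (χ : AddChar Γ Circle) : (-x).eval χ = (x.eval χ)⁻¹ := rfl

theorem Bohr.extend_one : Bohr.extend (1 : AddChar Γ Circle) = 1 := by
  ext x
  rw [Bohr.extend_apply, Bohr.eval_one]
  simp

theorem Bohr.extend_mul (χ ψ : AddChar Γ Circle) :
    Bohr.extend (χ * ψ) = Bohr.extend χ * Bohr.extend ψ := by
  ext x
  rw [Bohr.extend_apply, Bohr.eval_mul]
  simp [Bohr.extend_apply]

theorem Bohr.extend_inv (χ : AddChar Γ Circle) : Bohr.extend χ⁻¹ = star (Bohr.extend χ) := by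
  ext x
  rw [Bohr.extend_apply, Bohr.eval_inv, Circle.coe_inv_eq_conj]
  rfl

theorem Bohr.norm_extend_apply (χ : AddChar Γ Circle) (x : Bohr Γ) : ‖Bohr.extend χ x‖ = 1 :=
  Circle.norm_coe _

theorem Bohr.extend_add (χ : AddChar Γ Circle) (x y : Bohr Γ) :
    Bohr.extend χ (x + y) = Bohr.extend χ x * Bohr.extend χ y := by
  rw [Bohr.extend_apply, Bohr.eval_add, Circle.coe_mul]
  rfl

theorem Bohr.extend_neg (χ : AddChar Γ Circle) (x : Bohr Γ) :
    Bohr.extend χ (-x) = (starRingEnd ℂ) (Bohr.extend χ x) := by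
  rw [Bohr.extend_apply, Bohr.eval_neg, Circle.coe_inv_eq_conj]
  rfl

instance : (bohrHaar Γ).Regular :=
  inferInstanceAs (Measure.addHaarMeasure (⊤ : TopologicalSpace.PositiveCompacts (Bohr Γ))).Regular

theorem integral_extend {χ : AddChar Γ Circle} (h : χ ≠ 1) :
    ∫ x, Bohr.extend χ x ∂bohrHaar Γ = 0 := by
  obtain ⟨γ, hγ⟩ := AddChar.exists_apply_ne_one h
  have h1 := integral_add_left_eq_self (μ := bohrHaar Γ) (fun x => Bohr.extend χ x)
    (Bohr.ofGroup γ)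
  simp only [Bohr.extend_add, Bohr.extend_ofGroup] at h1
  rw [integral_const_mul] at h1
  by_contra h0
  exact hγ (Circle.ext (mul_right_cancel₀ h0 (by simpa using h1)))

/-- A character of `Γ` as an element of `L²(bΓ)`. -/
def bohrCharL2 (χ : AddChar Γ Circle) : Lp ℂ 2 (bohrHaar Γ) :=
  ContinuousMap.toLp (E := ℂ) 2 (bohrHaar Γ) ℂ (Bohr.extend χ)

theorem orthonormal_bohrCharL2 : Orthonormal ℂ (bohrCharL2 (Γ := Γ)) := by
  classical
  rw [orthonormal_iff_ite]
  intro χ ψ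
  rw [bohrCharL2, bohrCharL2, ContinuousMap.inner_toLp]
  have h1 : ∀ x, Bohr.extend ψ x * (starRingEnd ℂ) (Bohr.extend χ x) =
      Bohr.extend (χ⁻¹ * ψ) x := fun x => by
    rw [Bohr.extend_mul, Bohr.extend_inv, mul_comm]
    rfl
  simp only [h1]
  split_ifs with h
  · rw [h, inv_mul_cancel, Bohr.extend_one]
    simp
  · exact integral_extend fun h1 => h (inv_mul_eq_one.1 h1)

theorem summable_densityTerm {m : LInf Γ →ₗ[ℂ] ℂ} (hm : IsMean m)
    (h : ∀ χ : AddChar Γ Circle, χ ≠ 1 → m (charInf χ) = 0) (f : LInf Γ) :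
    Summable (densityTerm m f) :=
  summable_smul_of_orthonormal orthonormal_bohrCharL2 (summable_sq_meanFourierCoeff hm h f)

theorem hasSum_density {m : LInf Γ →ₗ[ℂ] ℂ} (hm : IsMean m)
    (h : ∀ χ : AddChar Γ Circle, χ ≠ 1 → m (charInf χ) = 0) (f : LInf Γ) :
    HasSum (fun χ => meanFourierCoeff m f χ • bohrCharL2 χ) (density m f) :=
  (summable_densityTerm hm h f).hasSum

/-! ### Convolutions -/

theorem measurePreserving_const_sub (x : Bohr Γ) :
    MeasurePreserving (fun t => x - t) (bohrHaar Γ) (bohrHaar Γ) :=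
  Measure.measurePreserving_sub_left (bohrHaar Γ) x

/-- This makes `F ↦ (F * G)(x)` continuous on `L²` for each single `x`, so the series of `F` may be
convolved termwise at every point, not just almost everywhere. -/
theorem bohrConv_eq_inner (F G : Lp ℂ 2 (bohrHaar Γ)) (x : Bohr Γ) :
    bohrConv F G x = inner ℂ
      (star (Lp.compMeasurePreserving (fun t => x - t) (measurePreserving_const_sub x) G)) F := by
  rw [L2.inner_def, bohrConv, convolution_def]
  refine integral_congr_ae ?_
  filter_upwards [Lp.coeFn_star (Lp.compMeasurePreserving (fun t => x - t)
    (measurePreserving_const_sub x) G),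
    Lp.coeFn_compMeasurePreserving G (measurePreserving_const_sub x)] with t h1 h2
  rw [h1, Pi.star_apply, h2]
  simp

theorem bohrConv_bohrCharL2 (χ : AddChar Γ Circle) (G : Lp ℂ 2 (bohrHaar Γ)) (x : Bohr Γ) :
    bohrConv (bohrCharL2 χ) G x = Bohr.extend χ x * inner ℂ (bohrCharL2 χ) G := by
  have hχ : (bohrCharL2 χ : Bohr Γ → ℂ) =ᵐ[bohrHaar Γ] Bohr.extend χ :=
    ContinuousMap.coeFn_toLp (𝕜 := ℂ) (p := 2) (bohrHaar Γ) (Bohr.extend χ)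
  rw [L2.inner_def, bohrConv, convolution_def, ← integral_const_mul]
  rw [← (measurePreserving_const_sub x).integral_comp'
    (f := MeasurableEquiv.subLeft x) (g := fun t => Bohr.extend χ x * inner ℂ (bohrCharL2 χ t) (G t))]
  refine integral_congr_ae ?_
  filter_upwards [hχ, (measurePreserving_const_sub x).quasiMeasurePreserving.ae hχ] with t h1 h2
  rw [h1]
  change _ = Bohr.extend χ x * inner ℂ (bohrCharL2 χ (x - t)) (G (x - t))
  rw [h2, sub_eq_add_neg, Bohr.extend_add, Bohr.extend_neg]
  have h3 : (starRingEnd ℂ) (Bohr.extend χ x) * Bohr.extend χ x = 1 := by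
    rw [RCLike.conj_mul, Bohr.norm_extend_apply]
    simp
  simp only [ContinuousLinearMap.mul_apply', RCLike.inner_apply, map_mul, Complex.conj_conj]
  linear_combination -(Bohr.extend χ t * G (x + -t)) * h3

theorem hasSum_bohrConv {a b : AddChar Γ Circle → ℂ} {F G : Lp ℂ 2 (bohrHaar Γ)}
    (hF : HasSum (fun χ => a χ • bohrCharL2 χ) F) (hG : HasSum (fun χ => b χ • bohrCharL2 χ) G)
    (x : Bohr Γ) : HasSum (fun χ => a χ * b χ * Bohr.extend χ x) (bohrConv F G x) := by
  have h1 : HasSum (fun χ => inner ℂ (star (Lp.compMeasurePreserving (fun t => x - t)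
      (measurePreserving_const_sub x) G)) (a χ • bohrCharL2 χ))
      (inner ℂ (star (Lp.compMeasurePreserving (fun t => x - t)
        (measurePreserving_const_sub x) G)) F) :=
    hF.mapL (innerSL ℂ _)
  simp only [inner_smul_right, ← bohrConv_eq_inner, bohrConv_bohrCharL2,
    inner_eq_of_hasSum_smul orthonormal_bohrCharL2 hG] at h1
  convert h1 using 1
  ext χ
  ring

/-! ### Means of continuous functions on the Bohr compactification -/

/-- The restriction to `Γ` of a continuous function on `bΓ`. -/
def Bohr.restrict : C(Bohr Γ, ℂ) →ₗ[ℂ] LInf Γ where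
  toFun φ := LInf.mk (fun γ => φ (Bohr.ofGroup γ)) ‖φ‖ fun _ => φ.norm_coe_le_norm _
  map_add' _ _ := rfl
  map_smul' _ _ := rfl

theorem Bohr.norm_restrict_le (φ : C(Bohr Γ, ℂ)) : ‖Bohr.restrict φ‖ ≤ ‖φ‖ :=
  lp.norm_le_of_forall_le (norm_nonneg _) fun _ => φ.norm_coe_le_norm _

theorem Bohr.continuous_restrict : Continuous (Bohr.restrict (Γ := Γ)) :=
  (LinearMap.mkContinuous Bohr.restrict 1 fun φ => by
    simpa using Bohr.norm_restrict_le φ).continuous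

/-- The trigonometric polynomials on `bΓ`. -/
def trigPoly (Γ : Type u) [AddCommGroup Γ] : StarSubalgebra ℂ C(Bohr Γ, ℂ) where
  carrier := Submodule.span ℂ (Set.range (Bohr.extend (Γ := Γ)))
  mul_mem' {f g} hf hg := by
    induction hf, hg using Submodule.span_induction₂ with
    | mem_mem f g hf hg =>
      obtain ⟨χ, rfl⟩ := hf
      obtain ⟨ψ, rfl⟩ := hg
      exact Submodule.subset_span ⟨χ * ψ, Bohr.extend_mul χ ψ⟩
    | zero_left g hg => rw [zero_mul]; exact zero_mem _
    | zero_right f hf => rw [mul_zero]; exact zero_mem _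
    | add_left f g h _ _ _ hf hg => rw [add_mul]; exact add_mem hf hg
    | add_right f g h _ _ _ hf hg => rw [mul_add]; exact add_mem hf hg
    | smul_left c f g _ _ h => rw [smul_mul_assoc]; exact Submodule.smul_mem _ _ h
    | smul_right c f g _ _ h => rw [mul_smul_comm]; exact Submodule.smul_mem _ _ h
  add_mem' := add_mem
  algebraMap_mem' c := by
    rw [Algebra.algebraMap_eq_smul_one, ← Bohr.extend_one]
    exact Submodule.smul_mem _ _ (Submodule.subset_span ⟨1, rfl⟩)
  star_mem' {f} hf := by
    change star f ∈ Submodule.span ℂ (Set.range (Bohr.extend (Γ := Γ)))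
    induction hf using Submodule.span_induction with
    | mem f hf =>
      obtain ⟨χ, rfl⟩ := hf
      exact Submodule.subset_span ⟨χ⁻¹, Bohr.extend_inv χ⟩
    | zero => rw [star_zero]; exact zero_mem _
    | add f g _ _ hf hg => rw [star_add]; exact add_mem hf hg
    | smul c f _ h => rw [star_smul]; exact Submodule.smul_mem _ _ h

/-- Stone–Weierstrass: points of `bΓ` are homomorphisms on the dual, so characters separate them. -/
theorem trigPoly_topologicalClosure : (trigPoly Γ).topologicalClosure = ⊤ := by
  refine ContinuousMap.starSubalgebra_topologicalClosure_eq_top_of_separatesPoints _ ?_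
  intro x y hxy
  obtain ⟨χ, hχ⟩ : ∃ χ, x.eval χ ≠ y.eval χ := by
    by_contra! h
    exact hxy (congrArg Additive.ofMul (PontryaginDual.ext (A := DiscreteDual Γ) h))
  exact ⟨_, ⟨Bohr.extend χ, Submodule.subset_span ⟨χ, rfl⟩, rfl⟩,
    fun h => hχ (Circle.ext h)⟩

/-- Both sides are continuous in the sup norm and agree on characters, whose span is dense. -/
theorem map_restrict_eq_integral {m : LInf Γ →ₗ[ℂ] ℂ} (hm : IsMean m)
    (h : ∀ χ : AddChar Γ Circle, χ ≠ 1 → m (charInf χ) = 0) (φ : C(Bohr Γ, ℂ)) :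
    m (Bohr.restrict φ) = ∫ x, φ x ∂bohrHaar Γ := by
  have hint : ∀ φ : C(Bohr Γ, ℂ), Integrable φ (bohrHaar Γ) := fun φ =>
    φ.continuous.integrable_of_hasCompactSupport (HasCompactSupport.of_compactSpace _)
  have hcont : Continuous fun φ : C(Bohr Γ, ℂ) => ∫ x, φ x ∂bohrHaar Γ := by
    refine (LipschitzWith.of_dist_le_mul (K := 1) fun φ ψ => ?_).continuous
    rw [dist_eq_norm, ← integral_sub (hint φ) (hint ψ), dist_eq_norm]
    refine (norm_integral_le_of_norm_le_const (C := ‖φ - ψ‖)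
      (.of_forall fun x => (φ - ψ).norm_coe_le_norm x)).trans ?_
    simp
  have hclosed : IsClosed {φ : C(Bohr Γ, ℂ) | m (Bohr.restrict φ) = ∫ x, φ x ∂bohrHaar Γ} :=
    isClosed_eq (hm.continuous.comp Bohr.continuous_restrict) hcont
  have hmem : φ ∈ closure (trigPoly Γ : Set C(Bohr Γ, ℂ)) := by
    rw [← StarSubalgebra.topologicalClosure_coe, trigPoly_topologicalClosure]
    trivial
  refine closure_minimal (fun f hf => ?_) hclosed hmem
  change f ∈ Submodule.span ℂ (Set.range (Bohr.extend (Γ := Γ))) at hf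
  change m (Bohr.restrict f) = ∫ x, f x ∂bohrHaar Γ
  induction hf using Submodule.span_induction with
  | mem f hf =>
    obtain ⟨χ, rfl⟩ := hf
    change m (charInf χ) = _
    rcases eq_or_ne χ 1 with rfl | hχ
    · rw [charInf_one, hm.1, Bohr.extend_one]
      simp
    · rw [h χ hχ, integral_extend hχ]
  | zero => simp
  | add f g _ _ hf hg =>
    rw [map_add, map_add, hf, hg, ← integral_add (hint f) (hint g)]
    rfl
  | smul c f _ hf =>
    rw [map_smul, map_smul, hf, smul_eq_mul, ← integral_const_mul]
    rfl

end

end DiscreteMeans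

/-! ### From orthogonality to sumset inclusions and the measure bound -/

namespace DiscreteMeans

universe u

open MeasureTheory Filter Topology

noncomputable section

variable {Γ : Type u} [AddCommGroup Γ]

/-! ### The finitely additive measure of a mean -/

theorem meanMeasure_mono {X : Type u} {m : LInf X →ₗ[ℂ] ℂ} (hm : IsMean m) {A B : Set X}
    (h : A ⊆ B) : meanMeasure m A ≤ meanMeasure m B := by
  have him : ∀ (C : Set X) x, (ind C x).im = 0 := fun C x => by
    by_cases hx : x ∈ C <;> simp [hx]
  refine hm.re_mono (him A) (him B) fun x => ?_
  by_cases hx : x ∈ A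
  · simp [hx, h hx]
  · by_cases hx' : x ∈ B <;> simp [hx, hx']

theorem meanMeasure_empty {X : Type u} {m : LInf X →ₗ[ℂ] ℂ} : meanMeasure m (∅ : Set X) = 0 := by
  have : ind (∅ : Set X) = 0 := by
    ext x
    simp
  rw [meanMeasure, this, map_zero, Complex.zero_re]

theorem meanMeasure_nonneg {X : Type u} {m : LInf X →ₗ[ℂ] ℂ} (hm : IsMean m) (A : Set X) :
    0 ≤ meanMeasure m A :=
  meanMeasure_empty.symm.trans_le (meanMeasure_mono hm (Set.empty_subset A))

theorem EssSubset.mono {X : Type u} {m : LInf X →ₗ[ℂ] ℂ} (hm : IsMean m) {A A' B : Set X}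
    (h : EssSubset m A B) (hA : A' ⊆ A) : EssSubset m A' B :=
  le_antisymm ((meanMeasure_mono hm (Set.sdiff_subset_sdiff_left hA)).trans_eq h)
    (meanMeasure_nonneg hm _)

theorem meanFourierCoeff_ind_inv {m : LInf Γ →ₗ[ℂ] ℂ} (hm : IsMean m) (A : Set Γ)
    (χ : AddChar Γ Circle) :
    meanFourierCoeff m (ind A) χ⁻¹ = (starRingEnd ℂ) (meanFourierCoeff m (ind A) χ) := by
  rw [meanFourierCoeff, meanFourierCoeff, charInf_inv]
  change _ = star _
  rw [← hm.map_star]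
  congr 1
  ext x
  have := congrArg (fun f : LInf Γ => f x) (star_ind A)
  simp only [LInf.star_apply] at this
  simp only [LInf.mul_apply, LInf.star_apply, star_mul', star_star, this]

/-- Markov's inequality on the exceptional set `E`: its indicator is an admissible `k`, and `δ 1_E ≤
1_E h`. -/
theorem essSubset_of_map_mul_eq_zero {X : Type u} {ν : LInf X →ₗ[ℂ] ℂ} {h : LInf X} {S : Set X}
    (hν : IsMean ν) (him : ∀ γ, (h γ).im = 0)
    (hS : ∀ k : LInf X, (∀ x ∈ S, k x = 0) → ν (k * h) = 0) {δ : ℝ} (hδ : 0 < δ) :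
    EssSubset ν {γ | δ ≤ (h γ).re} S := by
  set E := {γ | δ ≤ (h γ).re} \ S
  have h0 : ν (ind E * h) = 0 := hS _ fun x hx => by
    rw [ind_apply, Set.indicator_of_notMem fun hE => hE.2 hx]
  have h1 : (ν ((δ : ℂ) • ind E)).re ≤ (ν (ind E * h)).re := by
    refine hν.re_mono (fun x => ?_) (fun x => ?_) fun x => ?_
    · rw [LInf.smul_apply, ind_apply]
      by_cases hx : x ∈ E <;> simp [hx]
    · by_cases hx : x ∈ E <;> simp [hx, him x]
    · rw [LInf.smul_apply, ind_apply]
      by_cases hx : x ∈ E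
      · simpa [hx] using hx.1
      · simp [hx]
  rw [h0, map_smul, smul_eq_mul, Complex.re_ofReal_mul, Complex.zero_re] at h1
  exact le_antisymm (nonpos_of_mul_nonpos_right h1 hδ) (meanMeasure_nonneg hν E)

/-! ### Positivity sets of restrictions to `Γ` -/

section Positivity

variable {ν : LInf Γ →ₗ[ℂ] ℂ} {S : Set Γ} {H : C(Bohr Γ, ℂ)}

theorem essSubset_preimage_of_isCompact (hν : IsMean ν)
    (hess : ∀ δ : ℝ, 0 < δ → EssSubset ν {γ | δ ≤ (H (Bohr.ofGroup γ)).re} S) {V : Set (Bohr Γ)}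
    (hV : IsCompact V) (hpos : V ⊆ {x | 0 < (H x).re}) : EssSubset ν (Bohr.ofGroup ⁻¹' V) S := by
  rcases V.eq_empty_or_nonempty with rfl | hne
  -- No minimum exists on the empty set; any positive threshold serves.
  · exact (hess 1 one_pos).mono hν (by simp)
  · obtain ⟨x, hx, hmin⟩ := hV.exists_isMinOn hne
      (Complex.continuous_re.comp H.continuous).continuousOn
    exact (hess _ (hpos hx)).mono hν fun γ hγ => hmin hγ

/-- A continuous approximation of the indicator function of the set where `Re H` is positive. -/
def posApprox (H : C(Bohr Γ, ℂ)) (n : ℕ) : C(Bohr Γ, ℝ) where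
  toFun x := min 1 (n * max 0 (H x).re)
  continuous_toFun := by fun_prop

theorem posApprox_apply (H : C(Bohr Γ, ℂ)) (n : ℕ) (x : Bohr Γ) :
    posApprox H n x = min 1 (n * max 0 (H x).re) := rfl

theorem posApprox_nonneg (H : C(Bohr Γ, ℂ)) (n : ℕ) (x : Bohr Γ) : 0 ≤ posApprox H n x :=
  le_min zero_le_one (mul_nonneg n.cast_nonneg (le_max_left _ _))

theorem tendsto_posApprox (H : C(Bohr Γ, ℂ)) (x : Bohr Γ) :
    Tendsto (fun n => posApprox H n x) atTop
      (𝓝 ({x | 0 < (H x).re}.indicator (fun _ => (1 : ℝ)) x)) := by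
  by_cases hx : 0 < (H x).re
  · rw [Set.indicator_of_mem (show x ∈ {x | 0 < (H x).re} from hx)]
    refine tendsto_const_nhds.congr' ?_
    obtain ⟨N, hN⟩ := exists_nat_gt (1 / (H x).re)
    filter_upwards [eventually_ge_atTop N] with n hn
    rw [posApprox_apply, max_eq_right hx.le, min_eq_left]
    have : (N : ℝ) ≤ n := by exact_mod_cast hn
    exact ((div_lt_iff₀ hx).1 (hN.trans_le this)).le
  · rw [Set.indicator_of_notMem (show x ∉ {x | 0 < (H x).re} from hx)]
    refine tendsto_const_nhds.congr fun n => ?_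
    rw [posApprox_apply, max_eq_left (not_lt.1 hx), mul_zero, min_eq_right zero_le_one]

theorem integral_posApprox_le (hν : IsMean ν)
    (hchar : ∀ χ : AddChar Γ Circle, χ ≠ 1 → ν (charInf χ) = 0)
    (hess : ∀ δ : ℝ, 0 < δ → EssSubset ν {γ | δ ≤ (H (Bohr.ofGroup γ)).re} S) (n : ℕ) :
    ∫ x, posApprox H n x ∂bohrHaar Γ ≤ meanMeasure ν S := by
  set φ : C(Bohr Γ, ℂ) :=
    ⟨fun x => (posApprox H n x : ℂ), Complex.continuous_ofReal.comp (posApprox H n).continuous⟩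
  have h1 : (ν (Bohr.restrict φ)).re = ∫ x, posApprox H n x ∂bohrHaar Γ := by
    rw [map_restrict_eq_integral hν hchar φ]
    change (∫ x, (posApprox H n x : ℂ) ∂bohrHaar Γ).re = _
    rw [integral_complex_ofReal, Complex.ofReal_re]
  rw [← h1]
  -- Off `S` and off the null set where `Re H ≥ δ`, the approximation is at most `n δ`.
  have key : ∀ δ : ℝ, 0 < δ → (ν (Bohr.restrict φ)).re ≤ meanMeasure ν S + n * δ := by
    intro δ hδ
    set E := {γ | δ ≤ (H (Bohr.ofGroup γ)).re} \ S
    have hE : (ν (ind E)).re = 0 := hess δ hδ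
    have h2 : (ν (Bohr.restrict φ)).re ≤ (ν (ind S + ind E + ((n * δ : ℝ) : ℂ) • 1)).re := by
      refine hν.re_mono (fun γ => Complex.ofReal_im _) (fun γ => ?_) fun γ => ?_
      · by_cases hS : γ ∈ S <;> by_cases hE : γ ∈ E <;> simp [hS, hE]
      · change posApprox H n (Bohr.ofGroup γ) ≤ _
        have hnd : 0 ≤ n * δ := by positivity
        have hle : posApprox H n (Bohr.ofGroup γ) ≤ 1 := min_le_left _ _
        rw [LInf.add_apply, LInf.add_apply, LInf.smul_apply, LInf.one_apply, mul_one,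
          Complex.add_re, Complex.add_re, Complex.ofReal_re, ind_apply, ind_apply]
        by_cases hS : γ ∈ S
        · have : γ ∉ E := fun hE => hE.2 hS
          simp only [hS, this, Set.indicator_of_mem, Set.indicator_of_notMem, not_false_iff,
            Pi.one_apply, Complex.one_re, Complex.zero_re]
          linarith
        · by_cases hE : γ ∈ E
          · simp only [hS, hE, Set.indicator_of_mem, Set.indicator_of_notMem, not_false_iff,
              Pi.one_apply, Complex.one_re, Complex.zero_re]
            linarith
          · simp only [hS, hE, Set.indicator_of_notMem, not_false_iff, Complex.zero_re, zero_add]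
            have hlt : (H (Bohr.ofGroup γ)).re < δ := by
              by_contra! hge
              exact hE ⟨hge, hS⟩
            exact (min_le_right _ _).trans
              (mul_le_mul_of_nonneg_left (max_le hδ.le hlt.le) n.cast_nonneg)
    rw [map_add, map_add, map_smul, hν.1, Complex.add_re, Complex.add_re, hE, smul_eq_mul, mul_one,
      Complex.ofReal_re, add_zero] at h2
    exact h2
  refine le_of_forall_pos_le_add fun ε hε => ?_
  -- Dividing by `n + 1` keeps `n δ ≤ ε` and allows `n = 0`.
  refine (key (ε / (n + 1)) (by positivity)).trans ?_
  gcongr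
  rw [mul_div_assoc', div_le_iff₀ (by positivity)]
  nlinarith

/-- The mean is only finitely additive, so the limit in `n` is taken on `bΓ`, by dominated
convergence. -/
theorem measure_pos_le_meanMeasure (hν : IsMean ν)
    (hchar : ∀ χ : AddChar Γ Circle, χ ≠ 1 → ν (charInf χ) = 0)
    (hess : ∀ δ : ℝ, 0 < δ → EssSubset ν {γ | δ ≤ (H (Bohr.ofGroup γ)).re} S) :
    (bohrHaar Γ).real {x | 0 < (H x).re} ≤ meanMeasure ν S := by
  have hmeas : MeasurableSet {x | 0 < (H x).re} :=
    (isOpen_lt continuous_const (Complex.continuous_re.comp H.continuous)).measurableSet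
  have hlim : Tendsto (fun n => ∫ x, posApprox H n x ∂bohrHaar Γ) atTop
      (𝓝 (∫ x, {x | 0 < (H x).re}.indicator (fun _ => (1 : ℝ)) x ∂bohrHaar Γ)) := by
    refine tendsto_integral_of_dominated_convergence (fun _ => 1)
      (fun n => (posApprox H n).continuous.aestronglyMeasurable) (integrable_const _)
      (fun n => .of_forall fun x => ?_) (.of_forall fun x => tendsto_posApprox H x)
    rw [Real.norm_of_nonneg (posApprox_nonneg H n x)]
    exact min_le_left _ _
  rw [integral_indicator_const _ hmeas, smul_eq_mul, mul_one] at hlim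
  exact le_of_tendsto' hlim (integral_posApprox_le hν hchar hess)

end Positivity

end

end DiscreteMeans

theorem lemma3p8 {Γ : Type*} [AddCommGroup Γ] (ν η : LInf Γ →ₗ[ℂ] ℂ)
    (hν : IsExtremeInvariantMean ν) (hη : IsFSMean η) (A B : Set Γ)
    (htilde : Bohr Γ → ℂ)
    (htilde_def : htilde = bohrConv (density ν (ind A)) (density η (ind B))) :
    -- the two series defining the densities converge in `L²(bΓ)`, and `htilde` is real-valued
    Summable (densityTerm ν (ind A)) ∧
    Summable (densityTerm η (ind B)) ∧
    (∀ x, (htilde x).im = 0) ∧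
    -- the restriction `h` of `htilde` to `Γ` is bounded
    ∃ h : LInf Γ, (∀ γ, h γ = htilde (Bohr.ofGroup γ)) ∧
      -- uniform convergence (of the finite partial sums) to `h`
      TendstoUniformly
        (fun (S : Finset (AddChar Γ Circle)) (γ : Γ) =>
          ∑ χ ∈ S, meanFourierCoeff ν (ind A) χ * meanFourierCoeff η (ind B) χ * (χ γ : ℂ))
        h Filter.atTop ∧
      ν (h * ind (A + B)) = ν h ∧
      (∀ δ : ℝ, 0 < δ → EssSubset ν {γ | δ ≤ (h γ).re} (A + B)) ∧
      (∀ V : Set (Bohr Γ), IsCompact V → V ⊆ {x | 0 < (htilde x).re} →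
        EssSubset ν (Bohr.ofGroup ⁻¹' V) (A + B)) ∧
      (bohrHaar Γ).real {x | 0 < (htilde x).re} ≤ meanMeasure ν (A + B) := by
  have hi := hν.isInvariantMean
  have hcν : ∀ χ : AddChar Γ Circle, χ ≠ 1 → ν (charInf χ) = 0 := fun _ => hi.map_charInf
  have hcη : ∀ χ : AddChar Γ Circle, χ ≠ 1 → η (charInf χ) = 0 := fun _ => hη.map_charInf
  set a : AddChar Γ Circle → ℂ := fun χ =>
    meanFourierCoeff ν (ind A) χ * meanFourierCoeff η (ind B) χ with ha
  have hsum : Summable fun χ => ‖a χ‖ :=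
    summable_mul_of_summable_sq (summable_sq_meanFourierCoeff hi.isMean hcν (ind A))
      (summable_sq_meanFourierCoeff hη.isMean hcη (ind B))
  have hsumH : Summable fun χ => a χ • Bohr.extend χ := by
    refine .of_norm_bounded hsum fun χ => ?_
    rw [norm_smul]
    exact mul_le_of_le_one_right (norm_nonneg _)
      ((ContinuousMap.norm_le _ zero_le_one).2 fun x => (Bohr.norm_extend_apply χ x).le)
  -- The sum is taken in `C(bΓ)`, so it is continuous. It agrees with the convolution at every
  -- point, which makes evaluation on the possibly null set `Γ` meaningful.
  obtain ⟨H, hH⟩ := hsumH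
  have hHx : ∀ x, HasSum (fun χ => a χ * Bohr.extend χ x) (H x) := fun x =>
    hH.mapL (ContinuousMap.evalCLM ℂ x)
  have hHt : ∀ x, htilde x = H x := fun x => by
    rw [htilde_def]
    exact (hasSum_bohrConv (hasSum_density hi.isMean hcν (ind A))
      (hasSum_density hη.isMean hcη (ind B)) x).unique (hHx x)
  have hreal : ∀ x, (H x).im = 0 := fun x => by
    rw [← Complex.conj_eq_iff_im]
    have h1 : HasSum (fun χ => (starRingEnd ℂ) (a χ * Bohr.extend χ x)) ((starRingEnd ℂ) (H x)) :=
      (hHx x).star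
    refine h1.unique ?_
    -- Coefficients of indicators at `χ⁻¹` and `χ` are conjugate, so conjugation only permutes the
    -- terms.
    have h2 := (Equiv.inv (AddChar Γ Circle)).hasSum_iff.2 (hHx x)
    convert h2 using 1
    ext χ
    simp only [Function.comp_apply, Equiv.inv_apply, ha, meanFourierCoeff_ind_inv hi.isMean,
      meanFourierCoeff_ind_inv hη.isMean, Bohr.extend_inv, map_mul]
    rfl
  have hh : HasSum (fun χ => a χ • charInf χ) (Bohr.restrict H) :=
    hH.map Bohr.restrict Bohr.continuous_restrict
  have hzero : ∀ k : LInf Γ, (∀ x ∈ A + B, k x = 0) → ν (k * Bohr.restrict H) = 0 :=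
    fun k hk => hν.map_mul_eq_zero_of_hasSum hη A B hh hk
  have hess : ∀ δ : ℝ, 0 < δ → EssSubset ν {γ | δ ≤ (H (Bohr.ofGroup γ)).re} (A + B) :=
    fun δ hδ => essSubset_of_map_mul_eq_zero hi.isMean (h := Bohr.restrict H)
      (fun γ => hreal _) hzero hδ
  obtain rfl : htilde = H := funext hHt
  refine ⟨summable_densityTerm hi.isMean hcν _, summable_densityTerm hη.isMean hcη _, hreal,
    Bohr.restrict H, fun γ => rfl, ?_, ?_, hess,
    fun V hV hpos => essSubset_preimage_of_isCompact hi.isMean hess hV hpos,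
    measure_pos_le_meanMeasure hi.isMean hcν hess⟩
  · rw [Metric.tendstoUniformly_iff]
    intro ε hε
    filter_upwards [Metric.tendsto_nhds.1 hh ε hε] with S hS γ
    rw [dist_comm, dist_eq_norm] at hS
    have h1 := LInf.norm_apply_le (Bohr.restrict H - ∑ χ ∈ S, a χ • charInf χ) γ
    rw [LInf.sub_apply, lp.coeFn_sum, Finset.sum_apply] at h1
    rw [dist_eq_norm]
    exact h1.trans_lt hS
  · have h1 := hzero (1 - ind (A + B)) fun x hx => by simp [hx]
    rw [sub_mul, one_mul, map_sub, sub_eq_zero, mul_comm] at h1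
    exact h1.symm
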